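/- Let $p$ be a prime and $n\ge 2$. Let $R=\mathbb{F}_p[[t]]$ with maximal ideal $\mathfrak m=(t)$, and let $G=\mathrm{SL}_n(R)$ with its $R$-analytic structure as a closed submanifold of the affine space $R^{n^2}$ of $n\times n$ matrices. A filtration series of $G$ is a descending sequence $\{G_k\}_{k\in\mathbb N}$ of open subgroups with trivial intersection. It defines the metric $d(x,y)=\inf\{|G:G_k|^{-1} : xy^{-1}\in G_k\}$ on $G$ (with $d(x,y)=\infty$ if $xy^{-1}\notin G_0$), and $\operatorname{hdim}_{\{G_k\}}(H)$ denotes the Hausdorff dimension of $H\subseteq G$ with respect to this metric. An open $R$-standard subgroup $(S,\phi)$ of $G$, of level $N\ge 1$ and dimension $d$, is an open subgroup $S$ together with a homeomorphism $\phi\colon S\to(\mathfrak m^N)^{d}$ which is a chart of the $R$-analytic manifold $G$ (that is, $\phi$ and $\phi^{-1}$ are analytic) with $\phi(1)=0$ and $\phi(xy)=\mathbf F(\phi(x),\phi(y))$ for all $x,y\in S$, for some $d$-dimensional formal group law $\mathbf F$ over $R$. It induces the $R$-standard filtration $S_k=\phi^{-1}\big((\mathfrak m^{N+k})^{d}\big)$,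 $k\in\mathbb N$, of $G$. A subgroup $H\le G$ has $R$-standard Hausdorff dimension $\alpha$ if $\operatorname{hdim}_{\{S_k\}}(H)=\alpha$ for every $R$-standard filtration $\{S_k\}$ of $G$ (at least one such filtration exists). Then the $R$-standard Hausdorff spectrum of $G$, that is, the set of all $R$-standard Hausdorff dimensions of closed subgroups of $G$, contains the real interval $$\left[0,\ \frac{n(n+1)-2}{2n^2-2}\right].$$ In other words: $G$ has an $R$-standard filtration, and for every real $\alpha$ in this interval there is a closed subgroup $H$ of $G$ such that $\operatorname{hdim}_{\{S_k\}}(H)=\alpha$ for every $R$-standard filtration $\{S_k\}$ of $G$. -/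

import Mathlib

open scoped ENNReal PowerSeries.WithPiTopology

namespace StandardHausdorff

noncomputable section

/-! ### Filtration series and the Hausdorff dimension they define -/

/-- A filtration series of a topological group `G`: a descending sequence of open subgroups
with trivial intersection. -/
structure Filtration (G : Type*) [Group G] [TopologicalSpace G] where
  /-- The `n`-th term of the series. -/
  term : ℕ → Subgroup G
  antitone : Antitone term
  isOpen : ∀ n, IsOpen (term n : Set G)
  iInf_eq_bot : ⨅ n, term n = ⊥

namespace Filtration

open Classical in
/-- The distance `d(x, y) = inf {|G : G_n|⁻¹ : x y⁻¹ ∈ G_n}` of a filtration series. The case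
`x = y` is singled out only for the sake of finite groups: for infinite compact `G` the infimum
vanishes there by itself, see `dist_eq_iInf`. If `x y⁻¹` does not even lie in `G_0`, then the
infimum is over the empty set and the distance is `∞`; this convention has no influence on
Hausdorff dimensions, which only depend on small distances. -/
def dist {G : Type*} [Group G] [TopologicalSpace G] (𝓕 : Filtration G) (x y : G) : ℝ≥0∞ :=
  if x = y then 0
  else ⨅ (n : ℕ) (_ : x * y⁻¹ ∈ 𝓕.term n), ((𝓕.term n).index : ℝ≥0∞)⁻¹

variable {G : Type*} [Group G] [TopologicalSpace G] [IsTopologicalGroup G] [CompactSpace G]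
variable (𝓕 : Filtration G)

theorem finiteIndex (n : ℕ) : (𝓕.term n).FiniteIndex := by
  have := Subgroup.quotient_finite_of_isOpen (𝓕.term n) (𝓕.isOpen n)
  exact Subgroup.finiteIndex_of_finite_quotient

theorem inv_index_anti {m n : ℕ} (h : m ≤ n) :
    ((𝓕.term n).index : ℝ≥0∞)⁻¹ ≤ ((𝓕.term m).index : ℝ≥0∞)⁻¹ := by
  have := 𝓕.finiteIndex n
  rw [ENNReal.inv_le_inv, Nat.cast_le]
  exact Subgroup.index_antitone (𝓕.antitone h)

/-- On an infinite compact group, the distance is given by the infimum also for `x = y`. -/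
theorem dist_eq_iInf [Infinite G] (x y : G) :
    𝓕.dist x y = ⨅ (n : ℕ) (_ : x * y⁻¹ ∈ 𝓕.term n), ((𝓕.term n).index : ℝ≥0∞)⁻¹ := by
  by_cases hxy : x = y
  swap
  · simp [dist, hxy]
  subst hxy
  simp only [dist, if_true, mul_inv_cancel, one_mem, iInf_pos]
  by_contra hne
  obtain ⟨B, hB⟩ := ENNReal.exists_inv_nat_lt (Ne.symm hne)
  have hbd : ∀ n, (𝓕.term n).index ≤ B := fun n => by
    have := hB.le.trans (iInf_le _ n)
    rwa [ENNReal.inv_le_inv, Nat.cast_le] at this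
  have hfin : (Set.range fun n => (𝓕.term n).index).Finite :=
    (Set.finite_Iic B).subset (by rintro _ ⟨n, rfl⟩; exact hbd n)
  obtain ⟨_, ⟨n, rfl⟩, hn⟩ := hfin.exists_maximal (Set.range_nonempty _)
  have hbot : 𝓕.term n = ⊥ := by
    rw [← 𝓕.iInf_eq_bot]
    refine le_antisymm (le_iInf fun m => ?_) (iInf_le _ n)
    have h1 := 𝓕.finiteIndex (max m n)
    have hle := 𝓕.antitone (le_max_right m n)
    have h2 := Subgroup.relIndex_mul_index hle
    have h3 : (𝓕.term (max m n)).index ≤ (𝓕.term n).index :=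
      hn ⟨max m n, rfl⟩ (Subgroup.index_antitone hle)
    have h4 := h1.index_ne_zero
    have h5 : (𝓕.term (max m n)).relIndex (𝓕.term n) = 1 := by
      rcases Nat.lt_trichotomy ((𝓕.term (max m n)).relIndex (𝓕.term n)) 1 with h | h | h
      · simp [Nat.lt_one_iff.1 h] at h2; exact absurd h2.symm h4
      · exact h
      · nlinarith [Nat.pos_of_ne_zero (𝓕.finiteIndex n).index_ne_zero]
    exact (Subgroup.relIndex_eq_one.1 h5).trans (𝓕.antitone (le_max_left m n))
  have := (𝓕.finiteIndex n).index_ne_zero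
  rw [hbot, Subgroup.index_bot] at this
  exact this Nat.card_eq_zero_of_infinite

/-- The metric space structure on `G` given by the distance of a filtration series. -/
@[reducible] def emetricSpace : EMetricSpace G where
  edist := 𝓕.dist
  edist_self x := by simp [dist]
  edist_comm x y := by
    have h : ∀ n, x * y⁻¹ ∈ 𝓕.term n ↔ y * x⁻¹ ∈ 𝓕.term n := fun n => by
      rw [← inv_mem_iff]; simp
    change 𝓕.dist x y = 𝓕.dist y x
    by_cases hxy : x = y
    · rw [hxy]
    · simp only [dist, h, hxy, Ne.symm hxy, if_false]
  edist_triangle x y z := by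
    by_cases hxy : x = y
    · subst hxy; simp
    by_cases hyz : y = z
    · subst hyz; simp
    by_cases hxz : x = z
    · subst hxz; simp [dist]
    have key : ∀ m n, x * y⁻¹ ∈ 𝓕.term m → y * z⁻¹ ∈ 𝓕.term n → 𝓕.dist x z ≤
        ((𝓕.term m).index : ℝ≥0∞)⁻¹ + ((𝓕.term n).index : ℝ≥0∞)⁻¹ := by
      intro m n hm hn
      have hmem : x * z⁻¹ ∈ 𝓕.term (min m n) := by
        have := mul_mem (𝓕.antitone (min_le_left m n) hm) (𝓕.antitone (min_le_right m n) hn)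
        simpa [mul_assoc] using this
      have h1 : 𝓕.dist x z ≤ ((𝓕.term (min m n)).index : ℝ≥0∞)⁻¹ := by
        simp only [dist, hxz, if_false]
        exact iInf₂_le (min m n) hmem
      refine h1.trans ?_
      rcases min_choice m n with h | h <;> rw [h]
      · exact le_self_add
      · exact le_add_self
    have e1 : 𝓕.dist x y =
        ⨅ (n : ℕ) (_ : x * y⁻¹ ∈ 𝓕.term n), ((𝓕.term n).index : ℝ≥0∞)⁻¹ := by simp [dist, hxy]
    have e2 : 𝓕.dist y z =
        ⨅ (n : ℕ) (_ : y * z⁻¹ ∈ 𝓕.term n), ((𝓕.term n).index : ℝ≥0∞)⁻¹ := by simp [dist, hyz]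
    change 𝓕.dist x z ≤ 𝓕.dist x y + 𝓕.dist y z
    rw [e1, e2]
    simp only [ENNReal.iInf_add, ENNReal.add_iInf]
    exact le_iInf₂ fun m hm => le_iInf₂ fun n hn => key _ _ (by assumption) (by assumption)
  eq_of_edist_eq_zero := by
    intro x y h
    by_contra hxy
    have h' : ∃ n, x * y⁻¹ ∉ 𝓕.term n := by
      by_contra! hc
      have : x * y⁻¹ ∈ ⨅ n, 𝓕.term n := Subgroup.mem_iInf.2 hc
      rw [𝓕.iInf_eq_bot, Subgroup.mem_bot, mul_inv_eq_one] at this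
      exact hxy this
    obtain ⟨n, hn⟩ := h'
    have hle : ((𝓕.term n).index : ℝ≥0∞)⁻¹ ≤ 𝓕.dist x y := by
      simp only [dist, hxy, if_false]
      refine le_iInf₂ fun m hm => 𝓕.inv_index_anti ?_
      by_contra! hlt
      exact hn (𝓕.antitone hlt.le hm)
    have h0 : 𝓕.dist x y = 0 := h
    rw [h0] at hle
    simp at hle

/-- The Hausdorff dimension of a subset of `G` with respect to a filtration series. -/
def hdim (A : Set G) : ℝ≥0∞ := @dimH G 𝓕.emetricSpace A

end Filtration

/-! ### Power series over `𝔽_p[[t]]` -/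

/-- The ring `𝔽_p[[t]]`. Its topology is the one of coefficientwise convergence with discrete
`𝔽_p`, which is the `t`-adic one. -/
abbrev R (p : ℕ) : Type := PowerSeries (ZMod p)

instance (p : ℕ) [Fact p.Prime] : CompactSpace (R p) :=
  inferInstanceAs (CompactSpace ((Unit →₀ ℕ) → ZMod p))

section

variable {p : ℕ} [Fact p.Prime]

/-- The maximal ideal `𝔪 = (t)` of `𝔽_p[[t]]`. -/
abbrev 𝔪 (p : ℕ) [Fact p.Prime] : Ideal (R p) := IsLocalRing.maximalIdeal (R p)

/-- The polydisc `(𝔪^N)^(σ)` in affine space over `𝔽_p[[t]]`. -/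
abbrev Polydisc (p : ℕ) [Fact p.Prime] (N : ℕ) (σ : Type*) : Type _ :=
  {v : σ → R p // ∀ i, v i ∈ 𝔪 p ^ N}

/-- `F` converges at the point `x` with sum `v`, i.e. `F(x) = v`. -/
def EvalsTo {σ : Type*} (F : MvPowerSeries σ (R p)) (x : σ → R p) (v : R p) : Prop :=
  HasSum (fun α : σ →₀ ℕ => MvPowerSeries.coeff α F * α.prod fun i k => x i ^ k) v

/-- A formal group law of dimension `d` over `𝔽_p[[t]]`: a `d`-tuple `F(X, Y)` of power series
in the `2d` indeterminates `X = (X_1, …, X_d)` and `Y = (Y_1, …, Y_d)` such that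
`F(X, 0) = X`, `F(0, Y) = Y` and `F(F(X, Y), Z) = F(X, F(Y, Z))`. -/
structure FormalGroupLaw (p : ℕ) [Fact p.Prime] (d : ℕ) where
  /-- The power series `F_1, …, F_d`. -/
  toFun : Fin d → MvPowerSeries (Fin d ⊕ Fin d) (R p)
  constantCoeff_eq_zero : ∀ i, (toFun i).constantCoeff = 0
  right_zero : ∀ i, (toFun i).subst
    (Sum.elim MvPowerSeries.X 0 : Fin d ⊕ Fin d → MvPowerSeries (Fin d) (R p)) =
      MvPowerSeries.X i
  left_zero : ∀ i, (toFun i).subst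
    (Sum.elim 0 MvPowerSeries.X : Fin d ⊕ Fin d → MvPowerSeries (Fin d) (R p)) =
      MvPowerSeries.X i
  assoc : ∀ i,
    (toFun i).subst (Sum.elim
      (fun j => (toFun j).subst (Sum.elim
        (fun k => MvPowerSeries.X (Sum.inl k)) (fun k => MvPowerSeries.X (Sum.inr (Sum.inl k)))))
      (fun j => MvPowerSeries.X (Sum.inr (Sum.inr j))) :
        Fin d ⊕ Fin d → MvPowerSeries (Fin d ⊕ (Fin d ⊕ Fin d)) (R p)) =
    (toFun i).subst (Sum.elim
      (fun j => MvPowerSeries.X (Sum.inl j))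
      (fun j => (toFun j).subst (Sum.elim
        (fun k => MvPowerSeries.X (Sum.inr (Sum.inl k)))
        (fun k => MvPowerSeries.X (Sum.inr (Sum.inr k))))) :
        Fin d ⊕ Fin d → MvPowerSeries (Fin d ⊕ (Fin d ⊕ Fin d)) (R p))

/-- Given a set `Z` with coordinates `e : Z → 𝔽_p[[t]]^(ι)`, the map `g : Z → 𝔽_p[[t]]^(κ)` is
an analytic function of the coordinates `e`: around every `z₀ ∈ Z` there are power series `F_k`
over `𝔽_p[[t]]` with `g_k(z) = F_k(y)` for all `z` with `e(z) = e(z₀) + t^N y`, `y ∈ 𝔪^(ι)`.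
Because of the scaling by `t^N` this is the same as local representability by convergent power
series with coefficients in the fraction field `𝔽_p((t))`. -/
def IsAnalyticIn {Z ι κ : Type*} (e : Z → ι → R p) (g : Z → κ → R p) : Prop :=
  ∀ z₀ : Z, ∃ (N : ℕ) (F : κ → MvPowerSeries ι (R p)),
    ∀ (y : ι → R p) (z : Z), (∀ i, y i ∈ 𝔪 p) →
      (∀ i, e z i = e z₀ i + PowerSeries.X ^ N * y i) →
        ∀ k, EvalsTo (F k) y (g z k)

/-! ### Standard subgroups and standard filtrations -/

/-- Let `G` be a topological group, embedded as a closed analytic submanifold of affine space by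
`e : G → 𝔽_p[[t]]^(ι)`. An open `𝔽_p[[t]]`-standard subgroup `(S, φ)` of `G`, of level `N` and
dimension `d`, is an open subgroup with a global analytic chart `φ : S → (𝔪^N)^(d)` that maps `1`
to `0` and in which the multiplication is given by a formal group law. The two analyticity
conditions say that `φ` is a chart of the submanifold `G` of affine space: a homeomorphism which
is analytic in the ambient coordinates and whose inverse is analytic. -/
structure StandardSubgroup {G ι : Type*} [Group G] [TopologicalSpace G] (e : G → ι → R p) where
  /-- The underlying subgroup `S`. -/
  carrier : Subgroup G
  isOpen : IsOpen (carrier : Set G)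
  /-- The level `N`. -/
  level : ℕ
  one_le_level : 1 ≤ level
  /-- The dimension `d`. -/
  dim : ℕ
  /-- The chart `φ`. -/
  chart : carrier ≃ₜ Polydisc p level (Fin dim)
  chart_one : ∀ i, (chart 1).1 i = 0
  /-- The formal group law `F`. -/
  law : FormalGroupLaw p dim
  chart_mul : ∀ x y : carrier, ∀ i,
    EvalsTo (law.toFun i) (Sum.elim (chart x).1 (chart y).1) ((chart (x * y)).1 i)
  analytic_chart : IsAnalyticIn (fun x : carrier => e x) (fun x => (chart x).1)
  analytic_chart_symm : IsAnalyticIn (fun x : carrier => (chart x).1) (fun x => e x)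

theorem mem_maximalIdeal_pow {N : ℕ} {x : R p} :
    x ∈ 𝔪 p ^ N ↔ ∀ m < N, PowerSeries.coeff m x = 0 := by
  rw [𝔪, PowerSeries.maximalIdeal_eq_span_X, Ideal.span_singleton_pow, Ideal.mem_span_singleton,
    PowerSeries.X_pow_dvd_iff]

theorem isClosed_maximalIdeal_pow (N : ℕ) : IsClosed ((𝔪 p ^ N : Ideal (R p)) : Set (R p)) := by
  have : ((𝔪 p ^ N : Ideal (R p)) : Set (R p)) =
      ⋂ m, ⋂ (_ : m < N), {x | PowerSeries.coeff m x = 0} := by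
    ext x; simp [mem_maximalIdeal_pow]
  rw [this]
  exact isClosed_biInter fun m _ =>
    isClosed_eq (PowerSeries.WithPiTopology.continuous_coeff _ m) continuous_const

theorem isOpen_maximalIdeal_pow (N : ℕ) : IsOpen ((𝔪 p ^ N : Ideal (R p)) : Set (R p)) := by
  have : ((𝔪 p ^ N : Ideal (R p)) : Set (R p)) =
      ⋂ m ∈ Finset.range N, {x | PowerSeries.coeff m x = 0} := by
    ext x; simp [mem_maximalIdeal_pow]
  rw [this]
  refine isOpen_biInter_finset fun m _ => ?_
  exact (isOpen_discrete {(0 : ZMod p)}).preimage (PowerSeries.WithPiTopology.continuous_coeff _ m)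

/-- A power series without constant term maps `(𝔪^M)^(σ)` into `𝔪^M`. -/
theorem EvalsTo.mem {σ : Type*} {F : MvPowerSeries σ (R p)} {x : σ → R p} {v : R p} {M : ℕ}
    (h : EvalsTo F x v) (hF : F.constantCoeff = 0) (hx : ∀ i, x i ∈ 𝔪 p ^ M) : v ∈ 𝔪 p ^ M := by
  refine (isClosed_maximalIdeal_pow M).mem_of_tendsto h (Filter.Eventually.of_forall fun s => ?_)
  refine Ideal.sum_mem _ fun α _ => ?_
  by_cases hα : α = 0
  · subst hα
    have : MvPowerSeries.coeff 0 F = 0 := by simpa using hF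
    simp [this]
  · classical
    obtain ⟨i, hi⟩ := Finsupp.support_nonempty_iff.2 hα
    refine Ideal.mul_mem_left _ _ ?_
    rw [Finsupp.prod, ← Finset.mul_prod_erase _ _ hi]
    exact Ideal.mul_mem_right _ _
      (Ideal.pow_mem_of_mem _ (hx i) _ (Nat.pos_of_ne_zero (Finsupp.mem_support_iff.1 hi)))

namespace StandardSubgroup

variable {G ι : Type*} [Group G] [TopologicalSpace G] {e : G → ι → R p} (S : StandardSubgroup e)

/-- The set `S_n = φ⁻¹((𝔪^(N+n))^(d))`, as a subset of `S`. -/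
def ball (n : ℕ) : Set S.carrier := {x | ∀ i, (S.chart x).1 i ∈ 𝔪 p ^ (S.level + n)}

theorem isClosed_ball (n : ℕ) : IsClosed (S.ball n) := by
  have : S.ball n = ⋂ i, {x | (S.chart x).1 i ∈ 𝔪 p ^ (S.level + n)} := by ext; simp [ball]
  rw [this]
  exact isClosed_iInter fun i => (isClosed_maximalIdeal_pow _).preimage
    ((continuous_apply i).comp (continuous_subtype_val.comp S.chart.continuous))

theorem isOpen_ball (n : ℕ) : IsOpen (S.ball n) := by
  have : S.ball n = ⋂ i, {x | (S.chart x).1 i ∈ 𝔪 p ^ (S.level + n)} := by ext; simp [ball]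
  rw [this]
  exact isOpen_iInter_of_finite fun i => (isOpen_maximalIdeal_pow _).preimage
    ((continuous_apply i).comp (continuous_subtype_val.comp S.chart.continuous))

theorem one_mem_ball (n : ℕ) : (1 : S.carrier) ∈ S.ball n := fun i => by
  rw [S.chart_one]; exact zero_mem _

theorem mul_mem_ball (n : ℕ) {x y : S.carrier} (hx : x ∈ S.ball n) (hy : y ∈ S.ball n) :
    x * y ∈ S.ball n := fun i =>
  (S.chart_mul x y i).mem (S.law.constantCoeff_eq_zero i) (by rintro (j | j); exacts [hx j, hy j])

variable [IsTopologicalGroup G] [CompactSpace G]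

theorem inv_mem_ball (n : ℕ) {x : S.carrier} (hx : x ∈ S.ball n) : x⁻¹ ∈ S.ball n := by
  have : CompactSpace S.carrier :=
    isCompact_iff_compactSpace.1 (S.carrier.isClosed_of_isOpen S.isOpen).isCompact
  have h1 : x⁻¹ ∈ closure (Set.range (x ^ · : ℤ → S.carrier)) := subset_closure ⟨-1, by simp⟩
  rw [closure_range_zpow_eq_pow] at h1
  refine closure_minimal ?_ (S.isClosed_ball n) h1
  rintro _ ⟨k, rfl⟩
  induction k with
  | zero => simpa using S.one_mem_ball n
  | succ k ih => simpa [pow_succ] using S.mul_mem_ball n ih hx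

/-- The standard filtration `{S_n}` of `G` induced by the open standard subgroup `(S, φ)`,
`S_n = φ⁻¹((𝔪^(N+n))^(d))`. -/
def filtration : Filtration G where
  term n := Subgroup.map S.carrier.subtype
    { carrier := S.ball n
      one_mem' := S.one_mem_ball n
      mul_mem' := S.mul_mem_ball n
      inv_mem' := S.inv_mem_ball n }
  antitone m n h := Subgroup.map_mono fun _ hx i =>
    Ideal.pow_le_pow_right (Nat.add_le_add_left h _) (hx i)
  isOpen n := S.isOpen.isOpenMap_subtype_val _ (S.isOpen_ball n)
  iInf_eq_bot := by
    refine (Subgroup.eq_bot_iff_forall _).2 fun x hx => ?_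
    rw [Subgroup.mem_iInf] at hx
    obtain ⟨z, -, rfl⟩ := hx 0
    have hz : ∀ n, z ∈ S.ball n := fun n => by
      obtain ⟨w, hw, hwz⟩ := hx n
      rwa [← Subtype.ext hwz]
    have h1 : z = 1 := by
      apply S.chart.injective
      refine Subtype.ext (funext fun i => ?_)
      rw [S.chart_one]
      ext m
      simpa using mem_maximalIdeal_pow.1 (hz (m + 1) i) m (by omega)
    simp [h1]

end StandardSubgroup

/-! ### The standard Hausdorff spectrum -/

/-- The subset `H` of `G` has standard Hausdorff dimension `α`: the group `G` has an open standard
subgroup, and with respect to the filtration induced by any such subgroup the Hausdorff dimension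
of `H` is `α`. -/
def HasStandardHdim {G ι : Type*} [Group G] [TopologicalSpace G] [IsTopologicalGroup G]
    [CompactSpace G] (e : G → ι → R p) (H : Set G) (α : ℝ) : Prop :=
  0 ≤ α ∧ Nonempty (StandardSubgroup e) ∧
    ∀ S : StandardSubgroup e, S.filtration.hdim H = ENNReal.ofReal α

/-- The standard Hausdorff spectrum of `G`: the set of standard Hausdorff dimensions of the closed
subgroups of `G`. -/
def standardHausdorffSpectrum {G ι : Type*} [Group G] [TopologicalSpace G] [IsTopologicalGroup G]
    [CompactSpace G] (e : G → ι → R p) : Set ℝ :=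
  {α | ∃ H : Subgroup G, IsClosed (H : Set G) ∧ HasStandardHdim e (H : Set G) α}

end

/-- The special linear group `SL_n(𝔽_p[[t]])`, with the topology of entrywise convergence. -/
abbrev SL (n p : ℕ) : Type := Matrix.SpecialLinearGroup (Fin n) (R p)

instance (n p : ℕ) [Fact p.Prime] : CompactSpace (SL n p) := by
  have : CompactSpace (Matrix (Fin n) (Fin n) (R p)) :=
    inferInstanceAs (CompactSpace (Fin n → Fin n → R p))
  exact (Matrix.SpecialLinearGroup.isClosedEmbedding_val (n := Fin n) (R := R p)).compactSpace

/-- The matrix entries, which embed `SL_n(𝔽_p[[t]])` into affine `n²`-space. -/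
def SL.entries (n p : ℕ) (g : SL n p) (ij : Fin n × Fin n) : R p := g.1 ij.1 ij.2

end

end StandardHausdorff

/-!
The dimensions are realised by groups of upper triangular matrices. Fix a closed subgroup `T` of
`1 + t 𝔽_p[[t]]` and an integer `h`, and let `H` consist of the upper triangular matrices of
determinant one, congruent to `1` modulo `t`, whose diagonal entries lie in `T` and whose first `h`
superdiagonals vanish. If `T` meets about `p^(βk)` residue classes modulo `t^k`, then `H` meets
about `p^(σk)` of them, with `σ = β (n - 1) + P_h`, where `P_h` is the number of positions above the
`h`-th superdiagonal. Since `P_h - P_(h+1) ≤ n - 1`, the values of `σ` with `0 ≤ β ≤ 1` and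
`0 ≤ h ≤ n` fill the interval from `0` to the dimension `n (n + 1) / 2 - 1` of the Borel subgroup.

*Subgroups `T` of every density* (`exists_submonoid_growth`). The `i`-th coefficient of `t f' / f`
is `i` times the `i`-th coefficient of `f` plus an expression in the earlier ones. Requiring it to
vanish for all `i` in a set `E` of integers prime to `p` therefore defines a closed multiplicative
group in which the coefficients outside `E` are free and the others are determined. Its density is
one minus that of `E`, which can be any number in `[1/p, 1]`. Smaller densities come from raising
such a group to the power `p^j`, which divides the density by `p^j`.

*Independence of the filtration* (`SL.hdim_eq`). A chart and its inverse are given by power series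
with integral coefficients after rescaling, hence preserve congruences up to a bounded shift: every
standard filtration is interlaced with the congruence filtration (`SL.exists_interlacing`). For a
filtration interlaced with normal subgroups `Γ_k` such that `|G : Γ_k|` is of order `p^(Dk)` and
`|H : H ∩ Γ_k|` of order `p^(σk)`, the covering by cosets of `Γ_k` and the Haar measure of `H` give
`hdim H = σ / D` (`Filtration.hdim_eq`).

*Coordinates and existence of a standard subgroup* (`SL.nonempty_standardSubgroup`). A matrix of
determinant one is determined by its entries off a position `(l, l)` whose cofactor is a unit
(`eq_of_eq_off_corner`), and these entries can be prescribed. Over a power series ring this yields a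
generic matrix with determinant one; the entries of a product of two generic matrices form the
formal group law of the first congruence subgroup, and all identities for it follow from the
uniqueness and from the associativity of matrix multiplication. The same coordinates reduce the
computation of indices to counting residue classes entry by entry (`SL.relIndex_congruence`).
-/

namespace StandardHausdorff

/-! ### Hausdorff dimension in terms of indices -/

section Dimension

open MeasureTheory Filter Topology
open scoped NNReal Pointwise

/-- The mass distribution principle, along a geometric sequence of scales. -/
theorem le_dimH_of_measure_le {X : Type*} [EMetricSpace X] [MeasurableSpace X] [BorelSpace X]
    {A : Set X} {μ : Measure X} (hμ : μ A ≠ 0) {ρ c C : ℝ≥0} {r : ℝ≥0} (hρ : 0 < ρ) (hρ1 : ρ < 1)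
    (hc : 0 < c)
    (h : ∀ (k : ℕ) (s : Set X), Metric.ediam s ≤ (c * ρ ^ k : ℝ≥0) →
      μ s ≤ (C * (ρ ^ k) ^ (r : ℝ) : ℝ≥0)) : (r : ℝ≥0∞) ≤ dimH A := by
  rcases eq_or_ne r 0 with rfl | hr
  · simp
  have hr' : 0 < (r : ℝ) := by positivity
  set C' : ℝ≥0 := (C + 1) * (c * ρ)⁻¹ ^ (r : ℝ) with hC'
  have hC'0 : 0 < C' := by positivity
  have hC'e : (C' : ℝ≥0∞) ≠ 0 := by exact_mod_cast hC'0.ne'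
  have key : (C' : ℝ≥0∞)⁻¹ • μ ≤ μH[(r : ℝ)] := by
    refine Measure.le_hausdorffMeasure r _ (c / 2 : ℝ≥0) (by positivity) fun s hs => ?_
    rw [Measure.smul_apply, smul_eq_mul, mul_comm, ← div_eq_mul_inv]
    refine ENNReal.div_le_of_le_mul ?_
    have hlt : Metric.ediam s < c := hs.trans_lt (by exact_mod_cast NNReal.half_lt_self hc.ne')
    obtain ⟨δ, hδ⟩ : ∃ δ : ℝ≥0, (δ : ℝ≥0∞) = Metric.ediam s :=
      ⟨_, ENNReal.coe_toNNReal hlt.ne_top⟩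
    rw [← hδ] at hlt ⊢
    -- A set of diameter zero is null, since it satisfies the bound at every scale.
    rcases eq_or_ne δ 0 with rfl | hδ0
    · have : μ s ≤ 0 := by
        have hlim : Tendsto (fun k : ℕ => ((C * (ρ ^ k) ^ (r : ℝ) : ℝ≥0) : ℝ≥0∞)) atTop (𝓝 0) := by
          rw [← ENNReal.coe_zero, ENNReal.tendsto_coe]
          have h1 : Tendsto (fun k : ℕ => (ρ ^ k) ^ (r : ℝ)) atTop (𝓝 (0 ^ (r : ℝ))) :=
            (NNReal.continuous_rpow_const hr'.le).continuousAt.tendsto.comp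
              (tendsto_pow_atTop_nhds_zero_of_lt_one zero_le hρ1)
          rw [NNReal.zero_rpow hr'.ne'] at h1
          simpa using h1.const_mul C
        refine ge_of_tendsto' hlim fun k => h k s ?_
        rw [← hδ]
        exact_mod_cast (by positivity : 0 ≤ c * ρ ^ k)
      rw [le_antisymm this zero_le]; exact zero_le
    · have hδc : δ < c := by exact_mod_cast hlt
      have h1 : (δ / c : ℝ≥0) ≤ 1 := div_le_one_of_le₀ hδc.le zero_le
      obtain ⟨k, hk1, hk2⟩ := exists_nat_pow_near_of_lt_one (x := (δ : ℝ) / c) (y := (ρ : ℝ))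
        (by positivity) (by exact_mod_cast h1) (by exact_mod_cast hρ) (by exact_mod_cast hρ1)
      have hk1' : c * ρ * ρ ^ k ≤ δ := by
        have : ρ ^ (k + 1) < δ / c := by exact_mod_cast hk1
        rw [lt_div_iff₀ hc] at this
        calc c * ρ * ρ ^ k = ρ ^ (k + 1) * c := by ring
          _ ≤ δ := this.le
      have hk2' : δ ≤ c * ρ ^ k := by
        have : δ / c ≤ ρ ^ k := by exact_mod_cast hk2
        rwa [div_le_iff₀ hc, mul_comm] at this
      refine (h k s (by rw [← hδ]; exact_mod_cast hk2')).trans ?_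
      rw [← ENNReal.coe_rpow_of_nonneg _ hr'.le, ← ENNReal.coe_mul, ENNReal.coe_le_coe]
      have hcρ : 0 < c * ρ := mul_pos hc hρ
      calc C * (ρ ^ k) ^ (r : ℝ) ≤ (C + 1) * ((c * ρ)⁻¹ * δ) ^ (r : ℝ) := by
            gcongr
            · exact le_self_add
            · rwa [← div_eq_inv_mul, le_div_iff₀ hcρ, mul_comm]
        _ = δ ^ (r : ℝ) * C' := by rw [NNReal.mul_rpow, hC']; ring
  refine le_dimH_of_hausdorffMeasure_ne_zero fun h0 => hμ ?_
  have := key A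
  rw [h0, Measure.smul_apply, smul_eq_mul, le_zero_iff, mul_eq_zero] at this
  simpa using this

/-- A set with coverings of about `(ρ^k)^(-r)` parts of diameter at most `C ρ^k` has dimension at
most `r`. -/
theorem dimH_le_of_cover {X : Type*} [EMetricSpace X] {A : Set X} {ρ C : ℝ≥0} {r : ℝ≥0}
    (hρ1 : ρ < 1) {ι : ℕ → Type*} [∀ k, Fintype (ι k)] (t : ∀ k, ι k → Set X)
    (ht : ∀ᶠ k in atTop, ∀ i, Metric.ediam (t k i) ≤ (C * ρ ^ k : ℝ≥0))
    (hA : ∀ᶠ k in atTop, A ⊆ ⋃ i, t k i)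
    (hcard : ∀ᶠ k in atTop, (Fintype.card (ι k) : ℝ≥0) * (ρ ^ k) ^ (r : ℝ) ≤ C) :
    dimH A ≤ r := by
  borelize X
  have h := Measure.hausdorffMeasure_le_liminf_sum (r : ℝ) A (l := atTop)
    (fun k => ((C * ρ ^ k : ℝ≥0) : ℝ≥0∞)) (by
      rw [← ENNReal.coe_zero, ENNReal.tendsto_coe]
      simpa using (tendsto_pow_atTop_nhds_zero_of_lt_one zero_le hρ1).const_mul C) t ht hA
  refine dimH_le_of_hausdorffMeasure_ne_top (ne_top_of_le_ne_top
    (ENNReal.coe_ne_top (r := C ^ (r : ℝ) * C)) (h.trans ?_))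
  refine liminf_le_of_frequently_le' (Eventually.frequently ?_)
  filter_upwards [ht, hcard] with k h1 h2
  calc ∑ i, Metric.ediam (t k i) ^ (r : ℝ) ≤ ∑ i : ι k, ((C * ρ ^ k : ℝ≥0) : ℝ≥0∞) ^ (r : ℝ) :=
        Finset.sum_le_sum fun i _ => ENNReal.rpow_le_rpow (h1 i) (NNReal.coe_nonneg r)
    _ = ((C ^ (r : ℝ) * ((Fintype.card (ι k) : ℝ≥0) * (ρ ^ k) ^ (r : ℝ)) : ℝ≥0) : ℝ≥0∞) := by
        rw [Finset.sum_const, Finset.card_univ, ← ENNReal.coe_rpow_of_nonneg _ (NNReal.coe_nonneg r),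
          NNReal.mul_rpow, nsmul_eq_mul]
        push_cast
        ring
    _ ≤ _ := by
        rw [ENNReal.coe_le_coe]
        gcongr

namespace Filtration

/-- The underlying set of `G` with the metric of a filtration series: a type synonym, so that
the topology of this metric and the given topology of `G` can be told apart. -/
def Space {G : Type*} [Group G] [TopologicalSpace G] (_ : Filtration G) : Type _ := G

variable {G : Type*} [Group G] [TopologicalSpace G] [IsTopologicalGroup G] [CompactSpace G]

noncomputable instance (𝓕 : Filtration G) : EMetricSpace 𝓕.Space := 𝓕.emetricSpace

theorem hdim_eq_dimH (𝓕 : Filtration G) (A : Set G) : 𝓕.hdim A = dimH (X := 𝓕.Space) A := rfl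

variable (𝓕 : Filtration G) {Γ : ℕ → Subgroup G} {c : ℕ} {ρ A : ℝ≥0}

/-- If `Γ` is interlaced with the filtration and `|G : Γ_k|` is of order `ρ^(-k)`, then elements that
agree modulo `Γ_k` have distance of order at most `ρ^k`. -/
theorem dist_le_of_mem (h1 : ∀ k, Γ (k + c) ≤ 𝓕.term k) (h2 : ∀ k, 𝓕.term (k + c) ≤ Γ k)
    (hA : 0 < A) (hG : ∀ k, A⁻¹ ≤ (Γ k).index * ρ ^ k) {k : ℕ} {x y : G}
    (hxy : x * y⁻¹ ∈ Γ (k + c + c)) : 𝓕.dist x y ≤ (A * ρ ^ k : ℝ≥0) := by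
  by_cases he : x = y
  · simp [dist, he]
  simp only [dist, he, if_false]
  refine (iInf₂_le (k + c) (h1 _ hxy)).trans ?_
  have hfin := 𝓕.finiteIndex (k + c)
  have hle : (Γ k).index ≤ (𝓕.term (k + c)).index := Subgroup.index_antitone (h2 k)
  have h3 : A⁻¹ ≤ (𝓕.term (k + c)).index * ρ ^ k := (hG k).trans (by gcongr)
  have h4 : 0 < ((𝓕.term (k + c)).index : ℝ≥0) := by
    exact_mod_cast Nat.pos_of_ne_zero hfin.index_ne_zero
  rw [← ENNReal.coe_natCast, ← ENNReal.coe_inv h4.ne', ENNReal.coe_le_coe, inv_le_iff_one_le_mul₀ h4]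
  rw [inv_le_iff_one_le_mul₀ hA] at h3
  exact h3.trans_eq (by ring)

/-- The converse of `dist_le_of_mem`, up to the constant. -/
theorem mem_of_dist_lt (h1 : ∀ k, Γ (k + c) ≤ 𝓕.term k) (h2 : ∀ k, 𝓕.term (k + c) ≤ Γ k)
    (hA : 0 < A) (hρ : 0 < ρ) (hfi : ∀ k, (Γ k).index ≠ 0)
    (hG : ∀ k, (Γ k).index * ρ ^ k ≤ A) {k : ℕ} {x y : G}
    (hxy : 𝓕.dist x y < (A⁻¹ * ρ ^ (c + c) * ρ ^ k : ℝ≥0)) : x * y⁻¹ ∈ Γ k := by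
  by_contra hc
  have he : x ≠ y := by rintro rfl; simp [one_mem] at hc
  refine hxy.not_ge ?_
  simp only [dist, he, if_false]
  refine le_iInf₂ fun m hm => ?_
  have hmk : m ≤ k + c := by
    by_contra! hlt
    exact hc (h2 k (𝓕.antitone hlt.le hm))
  refine le_trans ?_ (𝓕.inv_index_anti hmk)
  have h5 : (Γ (k + c + c)).FiniteIndex := ⟨hfi _⟩
  have hle : (𝓕.term (k + c)).index ≤ (Γ (k + c + c)).index := Subgroup.index_antitone (h1 _)
  have hfin := 𝓕.finiteIndex (k + c)
  have h4 : 0 < ((𝓕.term (k + c)).index : ℝ≥0) := by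
    exact_mod_cast Nat.pos_of_ne_zero hfin.index_ne_zero
  have h3 : ((𝓕.term (k + c)).index : ℝ≥0) * ρ ^ (k + c + c) ≤ A := le_trans (by gcongr) (hG _)
  rw [← ENNReal.coe_natCast, ← ENNReal.coe_inv h4.ne', ENNReal.coe_le_coe,
    le_inv_comm₀ (by positivity) h4]
  rw [← le_div_iff₀ (by positivity)] at h3
  refine h3.trans_eq ?_
  rw [mul_inv, mul_inv, inv_inv, div_eq_mul_inv, mul_assoc, ← mul_inv, ← pow_add]
  congr 3; ring

/-- The dimension formula of Barnea and Shalev, for a filtration series interlaced with a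
series `Γ` of normal subgroups along which both the index in `G` and the index in `H` grow
exponentially, up to bounded factors. -/
theorem hdim_eq [∀ k, (Γ k).Normal] (hΓ : ∀ k, IsClosed (Γ k : Set G))
    (h1 : ∀ k, Γ (k + c) ≤ 𝓕.term k) (h2 : ∀ k, 𝓕.term (k + c) ≤ Γ k)
    (hA : 0 < A) (hρ : 0 < ρ) (hρ1 : ρ < 1)
    (hG1 : ∀ k, A⁻¹ ≤ (Γ k).index * ρ ^ k) (hG2 : ∀ k, (Γ k).index * ρ ^ k ≤ A)
    (H : Subgroup G) (hH : IsClosed (H : Set G)) {r : ℝ≥0}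
    (hH1 : ∀ k, A⁻¹ ≤ (Γ k).relIndex H * (ρ ^ k) ^ (r : ℝ))
    (hH2 : ∀ k, (Γ k).relIndex H * (ρ ^ k) ^ (r : ℝ) ≤ A) : 𝓕.hdim (H : Set G) = r := by
  have hrel : ∀ k, (Γ k).relIndex H ≠ 0 := fun k h0 => by
    have := hH1 k
    rw [h0] at this
    simp [hA.ne'] at this
  have hidx : ∀ k, (Γ k).index ≠ 0 := fun k h0 => by
    have := hG1 k
    rw [h0] at this
    simp [hA.ne'] at this
  rw [hdim_eq_dimH]
  refine le_antisymm ?_ ?_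
  · have hfin : ∀ k, ((Γ k).subgroupOf H).FiniteIndex := fun k => ⟨hrel k⟩
    let _ : ∀ k, Fintype (H ⧸ (Γ k).subgroupOf H) := fun k => Fintype.ofFinite _
    set C : ℝ≥0 := A + A * ((ρ ^ (c + c))⁻¹) ^ (r : ℝ) with hC
    refine dimH_le_of_cover (X := 𝓕.Space) (ρ := ρ) (C := C) hρ1
      (ι := fun k => H ⧸ (Γ (k + c + c)).subgroupOf H)
      (fun k q => {x : G | ∃ h : x ∈ H, (QuotientGroup.mk (⟨x, h⟩ : H) : H ⧸ _) = q})
      (.of_forall fun k q => ?_) (.of_forall fun k x hx => ?_) (.of_forall fun k => ?_)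
    · refine Metric.ediam_le fun (x : G) hx (y : G) hy => ?_
      obtain ⟨hx, rfl⟩ := hx
      obtain ⟨hy, he⟩ := hy
      have hmem : x * y⁻¹ ∈ Γ (k + c + c) := by
        rw [QuotientGroup.eq, Subgroup.mem_subgroupOf] at he
        simp only [Subgroup.coe_mul, Subgroup.coe_inv] at he
        exact (inferInstance : (Γ (k + c + c)).Normal).mem_comm_iff.1
          he
      refine (𝓕.dist_le_of_mem h1 h2 hA hG1 hmem).trans ?_
      rw [ENNReal.coe_le_coe]
      gcongr
      exact le_self_add
    · exact Set.mem_iUnion.2 ⟨_, hx, rfl⟩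
    · have h3 := hH2 (k + c + c)
      have h4 : Fintype.card (H ⧸ (Γ (k + c + c)).subgroupOf H) = (Γ (k + c + c)).relIndex H := by
        rw [← Nat.card_eq_fintype_card]; rfl
      rw [h4]
      have h5 : (ρ ^ k) ^ (r : ℝ) =
          (ρ ^ (k + c + c)) ^ (r : ℝ) * ((ρ ^ (c + c))⁻¹) ^ (r : ℝ) := by
        rw [← NNReal.mul_rpow, add_assoc, pow_add, mul_assoc, mul_inv_cancel₀ (by positivity), mul_one]
      rw [h5, ← mul_assoc]
      calc _ ≤ A * ((ρ ^ (c + c))⁻¹) ^ (r : ℝ) := by gcongr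
        _ ≤ C := le_add_self
  · borelize 𝓕.Space
    let _ : MeasurableSpace H := borel H
    have : BorelSpace H := ⟨rfl⟩
    have hHc : CompactSpace H := isCompact_iff_compactSpace.1 hH.isCompact
    let ν : Measure H := Measure.haarMeasure ⊤
    have hν : ν Set.univ = 1 := by
      simpa using Measure.haarMeasure_self (K₀ := (⊤ : TopologicalSpace.PositiveCompacts H))
    let ι : H → 𝓕.Space := fun x => (x : G)
    -- The metric topology is coarser than the given one.
    have hιc : Continuous ι := by
      refine continuous_def.2 fun U hU => ?_
      have hU' : IsOpen (show Set G from U) := by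
        rw [isOpen_iff_mem_nhds]
        intro x hx
        obtain ⟨ε, hε, hεU⟩ := EMetric.isOpen_iff.1 hU x hx
        have hlim : Tendsto (fun k : ℕ => ((A * ρ ^ k : ℝ≥0) : ℝ≥0∞)) atTop (𝓝 0) := by
          rw [← ENNReal.coe_zero, ENNReal.tendsto_coe]
          simpa using (tendsto_pow_atTop_nhds_zero_of_lt_one zero_le hρ1).const_mul A
        obtain ⟨k, hk⟩ := ((tendsto_order.1 hlim).2 ε hε).exists
        have hnhds : {y : G | y * x⁻¹ ∈ 𝓕.term (k + c + c + c)} ∈ 𝓝 x := by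
          refine ((𝓕.isOpen _).preimage (continuous_mul_const x⁻¹)).mem_nhds ?_
          simp [one_mem]
        refine Filter.mem_of_superset hnhds fun y hy => hεU ?_
        exact (𝓕.dist_le_of_mem h1 h2 hA hG1 (h2 _ hy)).trans_lt hk
      exact hU'.preimage continuous_subtype_val
    have hι : Measurable ι := hιc.measurable
    have hball : ∀ k (x : G), MeasurableSet (show Set 𝓕.Space from {y : G | y * x⁻¹ ∈ Γ k}) := by
      intro k x
      refine IsOpen.measurableSet (EMetric.isOpen_iff.2 fun (y : G) hy => ?_)
      refine ⟨(A⁻¹ * ρ ^ (c + c) * ρ ^ k : ℝ≥0), by positivity, fun (z : G) hz => ?_⟩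
      have := mul_mem (𝓕.mem_of_dist_lt h1 h2 hA hρ hidx hG2 hz) (show y * x⁻¹ ∈ Γ k from hy)
      change z * x⁻¹ ∈ Γ k
      simpa using this
    refine le_dimH_of_measure_le (X := 𝓕.Space) (μ := ν.map ι) (ρ := ρ)
      (c := A⁻¹ * ρ ^ (c + c) / 2) (C := A) ?_ hρ hρ1 (by positivity) fun k s hs => ?_
    · refine ne_of_gt (lt_of_lt_of_le ?_ (Measure.le_map_apply hι.aemeasurable _))
      have : ι ⁻¹' (H : Set G) = Set.univ := Set.eq_univ_of_forall fun x => x.2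
      rw [this, hν]
      exact one_pos
    · by_cases hsH : ∃ x : H, (x : G) ∈ (show Set G from s)
      · obtain ⟨x, hx⟩ := hsH
        have hsub : s ⊆ (show Set 𝓕.Space from {y : G | y * (x : G)⁻¹ ∈ Γ k}) := fun y hy => by
          refine 𝓕.mem_of_dist_lt h1 h2 hA hρ hidx hG2
            (((Metric.edist_le_ediam_of_mem hy hx).trans hs).trans_lt ?_)
          rw [ENNReal.coe_lt_coe]
          gcongr
          exact NNReal.half_lt_self (by positivity)
        refine (measure_mono hsub).trans ?_
        rw [Measure.map_apply hι (hball k x)]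
        -- The metric is defined by right cosets, the Haar measure is left invariant; both fit
        -- together because `Γ k` is normal.
        have hpre : ι ⁻¹' (show Set 𝓕.Space from {y : G | y * (x : G)⁻¹ ∈ Γ k}) =
            x • (((Γ k).subgroupOf H : Subgroup H) : Set H) := by
          ext y
          rw [Set.mem_smul_set_iff_inv_smul_mem]
          change (y : G) * (x : G)⁻¹ ∈ Γ k ↔ (x : G)⁻¹ * (y : G) ∈ Γ k
          exact (inferInstance : (Γ k).Normal).mem_comm_iff
        rw [hpre, measure_smul]
        have hfin : ((Γ k).subgroupOf H).FiniteIndex := ⟨hrel k⟩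
        have hidxm := Subgroup.index_mul_measure ((Γ k).subgroupOf H)
          (((hΓ k).preimage continuous_subtype_val).measurableSet) ν
        rw [hν] at hidxm
        have h3 : ν ((Γ k).subgroupOf H) = (((Γ k).relIndex H : ℝ≥0) : ℝ≥0∞)⁻¹ := by
          rw [ENNReal.coe_natCast]
          exact ENNReal.eq_inv_of_mul_eq_one_left (by rw [mul_comm]; exact hidxm)
        have h4 : (0 : ℝ≥0) < (Γ k).relIndex H := by exact_mod_cast Nat.pos_of_ne_zero (hrel k)
        rw [h3, ← ENNReal.coe_inv h4.ne', ENNReal.coe_le_coe, inv_le_iff_one_le_mul₀ h4]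
        have := hH1 k
        rw [inv_le_iff_one_le_mul₀ hA] at this
        exact this.trans_eq (by ring)
      · push Not at hsH
        have hsub : s ⊆ (show Set 𝓕.Space from (H : Set G)ᶜ) := fun y hy hyH => hsH ⟨y, hyH⟩ hy
        have hm : ν.map ι (show Set 𝓕.Space from (H : Set G)ᶜ) = 0 := by
          have hrange : Set.range ι = (show Set 𝓕.Space from (H : Set G)) := Subtype.range_coe
          have hcl : IsClosed (Set.range ι) := (isCompact_range hιc).isClosed
          rw [hrange] at hcl
          rw [Measure.map_apply hι hcl.measurableSet.compl]
          convert measure_empty (μ := ν)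
          exact Set.eq_empty_of_forall_notMem fun x hx => hx x.2
        rw [measure_mono_null hsub hm]
        exact zero_le

end Filtration

end Dimension

/-! ### Matrices of determinant one, described by all entries but one -/

section Corner

theorem updateRow_congr_of_eq_off_corner {m A : Type*} [DecidableEq m] {M M' : Matrix m m A}
    {l : m} (h : ∀ i j, (i, j) ≠ (l, l) → M i j = M' i j)
    (v : m → A) : M.updateRow l v = M'.updateRow l v := by
  ext i j
  by_cases hi : i = l
  · subst hi; simp
  · rw [Matrix.updateRow_ne hi, Matrix.updateRow_ne hi]
    exact h i j fun he => hi (Prod.ext_iff.1 he).1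

variable {m A : Type*} [Fintype m] [DecidableEq m] [CommRing A] {M M' : Matrix m m A} {l : m}

theorem adjugate_corner_congr (h : ∀ i j, (i, j) ≠ (l, l) → M i j = M' i j) :
    M.adjugate l l = M'.adjugate l l := by
  rw [Matrix.adjugate_apply, Matrix.adjugate_apply, updateRow_congr_of_eq_off_corner h]

/-- The determinant is affine in a diagonal entry, with slope the cofactor at this position. -/
theorem det_eq_det_add_corner (h : ∀ i j, (i, j) ≠ (l, l) → M i j = M' i j) :
    M'.det = M.det + (M' l l - M l l) * M.adjugate l l := by
  have hrow : M' l = M l + (M' l l - M l l) • Pi.single l 1 := by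
    ext j
    by_cases hj : j = l
    · subst hj; simp
    · have := h l j (fun he => hj (Prod.ext_iff.1 he).2)
      simp [hj, this]
  calc M'.det = (M'.updateRow l (M' l)).det := by rw [Matrix.updateRow_eq_self]
    _ = (M.updateRow l (M' l)).det := by rw [updateRow_congr_of_eq_off_corner h]
    _ = _ := by
      conv_lhs => rw [hrow]
      rw [Matrix.det_updateRow_add, Matrix.det_updateRow_smul, Matrix.updateRow_eq_self,
        ← Matrix.adjugate_apply]

/-- A matrix of determinant one is determined by its entries off a diagonal position whose
cofactor is a unit. -/
theorem eq_of_eq_off_corner (hM : M.det = 1) (hM' : M'.det = 1) (hu : IsUnit (M.adjugate l l))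
    (h : ∀ i j, (i, j) ≠ (l, l) → M i j = M' i j) : M = M' := by
  have h1 := det_eq_det_add_corner h
  rw [hM, hM', left_eq_add, hu.mul_left_eq_zero, sub_eq_zero] at h1
  ext i j
  by_cases hij : (i, j) = (l, l)
  · obtain ⟨h2, h3⟩ : i = l ∧ j = l := Prod.ext_iff.1 hij
    rw [h2, h3]
    exact h1.symm
  · exact h i j hij

theorem exists_det_eq_one_of_isUnit_adjugate (hu : IsUnit (M.adjugate l l)) :
    ∃ M' : Matrix m m A, M'.det = 1 ∧ ∀ i j, (i, j) ≠ (l, l) → M i j = M' i j := by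
  obtain ⟨u, hu⟩ := hu
  have h : ∀ i j, (i, j) ≠ (l, l) →
      M i j = (M + Matrix.single l l (u⁻¹ * (1 - M.det))) i j := by
    intro i j hij
    have : ¬ (l = i ∧ l = j) := fun ⟨h1, h2⟩ => hij (by rw [← h1, ← h2])
    simp [this]
  -- By `det_eq_det_add_corner` the corrected corner entry brings the determinant to one.
  refine ⟨_, ?_, h⟩
  rw [det_eq_det_add_corner h, ← hu]
  simp [mul_comm]

variable {κ : Type*} (ε : κ ≃ {ij : m × m // ij ≠ (l, l)})

/-- The generic deformation of a matrix `B`: a matrix of determinant one over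
the power series ring whose entries off the corner are those of `B` plus an indeterminate. It exists because the cofactor of the
corner has an invertible constant term. -/
theorem exists_genericMatrix (B : Matrix m m A) (hu : IsUnit (B.adjugate l l)) :
    ∃ M : Matrix m m (MvPowerSeries κ A), M.det = 1 ∧ IsUnit (M.adjugate l l) ∧
      ∀ k, M (ε k).1.1 (ε k).1.2 = MvPowerSeries.C (B (ε k).1.1 (ε k).1.2) + MvPowerSeries.X k := by
  let M₀ : Matrix m m (MvPowerSeries κ A) := fun i j =>
    MvPowerSeries.C (B i j) + if h : (i, j) ≠ (l, l) then MvPowerSeries.X (ε.symm ⟨(i, j), h⟩) else 0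
  have h0 : M₀.map MvPowerSeries.constantCoeff = B := by
    ext i j
    by_cases hij : (i, j) ≠ (l, l)
    · rw [Matrix.map_apply, show M₀ i j = _ + dite _ _ _ from rfl, dif_pos hij]; simp
    · rw [Matrix.map_apply, show M₀ i j = _ + dite _ _ _ from rfl, dif_neg hij]; simp
  have hu0 : IsUnit (M₀.adjugate l l) := by
    rw [MvPowerSeries.isUnit_iff_constantCoeff]
    have : (MvPowerSeries.constantCoeff (σ := κ) (R := A)) (M₀.adjugate l l) =
        (M₀.map MvPowerSeries.constantCoeff).adjugate l l := by
      rw [← RingHom.mapMatrix_apply, ← RingHom.map_adjugate]; rfl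
    rwa [this, h0]
  obtain ⟨M, hM, hMM⟩ := exists_det_eq_one_of_isUnit_adjugate hu0
  refine ⟨M, hM, adjugate_corner_congr hMM ▸ hu0, fun k => ?_⟩
  rw [← hMM _ _ (ε k).2]
  have : ((ε k).1.1, (ε k).1.2) ≠ (l, l) := (ε k).2
  rw [show M₀ (ε k).1.1 (ε k).1.2 = _ + dite _ _ _ from rfl, dif_pos this]
  simp

/-- The universal property of the generic matrix: a ring homomorphism maps it to the matrix of
determinant one whose entries off the corner are the images of those of the generic matrix. -/
theorem map_genericMatrix_eq {B : Matrix m m A} {M : Matrix m m (MvPowerSeries κ A)}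
    (hM : M.det = 1) (hu : IsUnit (M.adjugate l l))
    (hMk : ∀ k, M (ε k).1.1 (ε k).1.2 =
      MvPowerSeries.C (B (ε k).1.1 (ε k).1.2) + MvPowerSeries.X k)
    {A' : Type*} [CommRing A'] (ψ : MvPowerSeries κ A →+* A') {N : Matrix m m A'} (hN : N.det = 1)
    (h : ∀ k, N (ε k).1.1 (ε k).1.2 =
      ψ (MvPowerSeries.C (B (ε k).1.1 (ε k).1.2)) + ψ (MvPowerSeries.X k)) :
    M.map ψ = N := by
  refine eq_of_eq_off_corner (l := l) ?_ hN ?_ fun i j hij => ?_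
  · rw [← RingHom.mapMatrix_apply, ← RingHom.map_det, hM, map_one]
  · rw [← RingHom.mapMatrix_apply, ← RingHom.map_adjugate]
    exact hu.map ψ
  · obtain ⟨k, hk⟩ := ε.surjective ⟨(i, j), hij⟩
    have h1 : (ε k).1.1 = i := by rw [hk]
    have h2 : (ε k).1.2 = j := by rw [hk]
    have h3 := h k
    have h4 := congrArg ψ (hMk k)
    rw [h1, h2] at h3 h4
    rw [Matrix.map_apply, h4, h3, map_add]

end Corner

section Eval

variable {p : ℕ} [Fact p.Prime]

/-- Power series over `𝔽_p[[t]]` can be evaluated at points of the maximal ideal by a ring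
homomorphism. -/
theorem exists_eval {σ : Type*} [Finite σ] (v : σ → R p) (hv : ∀ i, v i ∈ 𝔪 p) :
    ∃ Ψ : MvPowerSeries σ (R p) →ₐ[R p] R p,
      (∀ F, EvalsTo F v (Ψ F)) ∧ ∀ i, Ψ (MvPowerSeries.X i) = v i := by
  let _ : UniformSpace (ZMod p) := ⊥
  have : DiscreteUniformity (ZMod p) := ⟨rfl⟩
  have hev : MvPowerSeries.HasEval v := by
    refine ⟨fun i => ?_, by simp [Filter.cofinite_eq_bot]⟩
    apply PowerSeries.WithPiTopology.isTopologicallyNilpotent_of_constantCoeff_zero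
    have := mem_maximalIdeal_pow (N := 1).1 ((pow_one (𝔪 p)).symm ▸ hv i) 0 one_pos
    simpa using this
  refine ⟨MvPowerSeries.aeval hev, fun F => ?_, fun i => ?_⟩
  · simpa [EvalsTo] using MvPowerSeries.hasSum_aeval hev F
  · simpa using MvPowerSeries.aeval_coe hev (MvPolynomial.X i)

end Eval

/-! ### The formal group law of `SL_n` -/

section FormalGroup

variable {p : ℕ} [Fact p.Prime]

open MvPowerSeries in
/-- The formal group law of `SL` in the coordinates given by the entries off the corner, minus those
of the identity matrix, together with its value at pairs of points of the maximal ideal. -/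
theorem exists_formalGroupLaw {m : Type*} [Fintype m] [DecidableEq m] {l : m} {d : ℕ}
    (ε : Fin d ≃ {ij : m × m // ij ≠ (l, l)}) :
    ∃ F : FormalGroupLaw p d, ∀ (v w : Fin d → R p) (x y : Matrix m m (R p)),
      (∀ k, v k ∈ 𝔪 p) → (∀ k, w k ∈ 𝔪 p) → x.det = 1 → y.det = 1 →
      (∀ k, x (ε k).1.1 (ε k).1.2 = (1 : Matrix m m (R p)) (ε k).1.1 (ε k).1.2 + v k) →
      (∀ k, y (ε k).1.1 (ε k).1.2 = (1 : Matrix m m (R p)) (ε k).1.1 (ε k).1.2 + w k) →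
      ∀ k, EvalsTo (F.toFun k) (Sum.elim v w)
        ((x * y) (ε k).1.1 (ε k).1.2 - (1 : Matrix m m (R p)) (ε k).1.1 (ε k).1.2) := by
  obtain ⟨M, hM, hu, hMk⟩ := exists_genericMatrix ε (1 : Matrix m m (R p)) (by simp)
  -- Substituting a tuple into the generic matrix gives the matrix with these coordinates.
  have hmap : ∀ {A' : Type} [CommRing A'] (ψ : MvPowerSeries (Fin d) (R p) →+* A')
      {N : Matrix m m A'}, N.det = 1 → (∀ k, N (ε k).1.1 (ε k).1.2 =
        (1 : Matrix m m A') (ε k).1.1 (ε k).1.2 + ψ (X k)) → M.map ψ = N := by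
    intro A' _ ψ N hN h
    refine map_genericMatrix_eq ε hM hu hMk ψ hN fun k => ?_
    rw [h]
    congr 1
    rw [Matrix.one_apply, Matrix.one_apply]
    split_ifs <;> simp
  have hsub : ∀ {σ τ : Type} [Finite σ] (a : σ → MvPowerSeries τ (R p)),
      (∀ i, (a i).constantCoeff = 0) → ∃ ψ : MvPowerSeries σ (R p) →+* MvPowerSeries τ (R p),
        (∀ f, ψ f = f.subst a) ∧ ∀ i, ψ (X i) = a i := fun a ha =>
    have ha' := hasSubst_of_constantCoeff_zero ha
    ⟨(substAlgHom (R := R p) ha').toRingHom, fun f => substAlgHom_apply ha' f,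
      fun i => substAlgHom_X ha' i⟩
  obtain ⟨ρl, -, hρl⟩ := hsub (fun k => X (Sum.inl k) :
    Fin d → MvPowerSeries (Fin d ⊕ Fin d) (R p)) fun i => by simp
  obtain ⟨ρr, -, hρr⟩ := hsub (fun k => X (Sum.inr k) :
    Fin d → MvPowerSeries (Fin d ⊕ Fin d) (R p)) fun i => by simp
  let P : Matrix m m (MvPowerSeries (Fin d ⊕ Fin d) (R p)) := M.map ρl * M.map ρr
  let F : Fin d → MvPowerSeries (Fin d ⊕ Fin d) (R p) := fun k =>
    P (ε k).1.1 (ε k).1.2 - (1 : Matrix m m _) (ε k).1.1 (ε k).1.2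
  -- A homomorphism carries `F` to the coordinates of the product of the two matrices whose
  -- coordinates are the images of the two tuples of indeterminates.
  have hF : ∀ {A' : Type} [CommRing A'] (ψ : MvPowerSeries (Fin d ⊕ Fin d) (R p) →+* A')
      {N₁ N₂ : Matrix m m A'}, N₁.det = 1 → N₂.det = 1 →
      (∀ k, N₁ (ε k).1.1 (ε k).1.2 =
        (1 : Matrix m m A') (ε k).1.1 (ε k).1.2 + ψ (X (Sum.inl k))) →
      (∀ k, N₂ (ε k).1.1 (ε k).1.2 =
        (1 : Matrix m m A') (ε k).1.1 (ε k).1.2 + ψ (X (Sum.inr k))) →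
      ∀ k, ψ (F k) = (N₁ * N₂) (ε k).1.1 (ε k).1.2 - (1 : Matrix m m A') (ε k).1.1 (ε k).1.2 := by
    intro A' _ ψ N₁ N₂ hN₁ hN₂ h₁ h₂ k
    have e1 : (M.map ρl).map ψ = N₁ := by
      rw [Matrix.map_map]
      refine hmap (ψ.comp ρl) hN₁ fun k => ?_
      rw [h₁]
      simp [hρl]
    have e2 : (M.map ρr).map ψ = N₂ := by
      rw [Matrix.map_map]
      refine hmap (ψ.comp ρr) hN₂ fun k => ?_
      rw [h₂]
      simp [hρr]
    have e3 : P.map ψ = N₁ * N₂ := by rw [Matrix.map_mul, e1, e2]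
    rw [map_sub, ← e3, Matrix.map_apply]
    congr 1
    rw [Matrix.one_apply, Matrix.one_apply]
    split_ifs <;> simp
  have hMX : ∀ k, M (ε k).1.1 (ε k).1.2 = (1 : Matrix m m _) (ε k).1.1 (ε k).1.2 + X k := by
    intro k
    rw [hMk, Matrix.one_apply, Matrix.one_apply]
    split_ifs <;> simp
  have hF0 : ∀ k, (F k).constantCoeff = 0 := by
    intro k
    rw [hF constantCoeff (N₁ := 1) (N₂ := 1) (by simp) (by simp) (by simp) (by simp)]
    simp
  -- The product of two matrices with given coordinates, after any substitution.
  have hFs : ∀ {τ : Type} (a : Fin d ⊕ Fin d → MvPowerSeries τ (R p)),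
      (∀ i, (a i).constantCoeff = 0) → ∀ {N₁ N₂ : Matrix m m (MvPowerSeries τ (R p))},
      N₁.det = 1 → N₂.det = 1 →
      (∀ k, N₁ (ε k).1.1 (ε k).1.2 = (1 : Matrix m m _) (ε k).1.1 (ε k).1.2 + a (Sum.inl k)) →
      (∀ k, N₂ (ε k).1.1 (ε k).1.2 = (1 : Matrix m m _) (ε k).1.1 (ε k).1.2 + a (Sum.inr k)) →
      ∀ k, (F k).subst a =
        (N₁ * N₂) (ε k).1.1 (ε k).1.2 - (1 : Matrix m m _) (ε k).1.1 (ε k).1.2 := by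
    intro τ a ha N₁ N₂ hN₁ hN₂ h₁ h₂ k
    obtain ⟨ψ, hψ, hψX⟩ := hsub a ha
    rw [← hψ]
    exact hF ψ hN₁ hN₂ (fun k => by rw [h₁, hψX]) (fun k => by rw [h₂, hψX]) k
  -- The three copies of the generic matrix over the power series ring in three tuples.
  have hgen : ∀ {τ : Type} (a : Fin d → τ), ∃ N : Matrix m m (MvPowerSeries τ (R p)), N.det = 1 ∧
      ∀ k, N (ε k).1.1 (ε k).1.2 = (1 : Matrix m m _) (ε k).1.1 (ε k).1.2 + X (a k) := by
    intro τ a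
    obtain ⟨ψ, -, hψX⟩ := hsub (fun k => X (a k) : Fin d → MvPowerSeries τ (R p)) fun i => by simp
    refine ⟨M.map ψ, ?_, fun k => ?_⟩
    · rw [← RingHom.mapMatrix_apply, ← RingHom.map_det, hM, map_one]
    · rw [Matrix.map_apply, hMX, map_add, hψX]
      congr 1
      rw [Matrix.one_apply, Matrix.one_apply]
      split_ifs <;> simp
  refine ⟨⟨F, hF0, fun k => ?_, fun k => ?_, fun k => ?_⟩, ?_⟩
  · rw [hFs _ (by rintro (i | i) <;> simp) hM (N₂ := 1) (by simp) (fun k => by simp [hMX])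
      (fun k => by simp)]
    simp [hMX]
  · rw [hFs _ (by rintro (i | i) <;> simp) (N₁ := 1) (by simp) hM (fun k => by simp)
      (fun k => by simp [hMX])]
    simp [hMX]
  · obtain ⟨N₁, hN₁, h₁⟩ := hgen (fun k : Fin d => (Sum.inl k : Fin d ⊕ (Fin d ⊕ Fin d)))
    obtain ⟨N₂, hN₂, h₂⟩ := hgen (fun k : Fin d => (Sum.inr (Sum.inl k) : Fin d ⊕ (Fin d ⊕ Fin d)))
    obtain ⟨N₃, hN₃, h₃⟩ := hgen (fun k : Fin d => (Sum.inr (Sum.inr k) : Fin d ⊕ (Fin d ⊕ Fin d)))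
    have h12 := hFs (Sum.elim (fun k => X (Sum.inl k)) (fun k => X (Sum.inr (Sum.inl k))))
      (by rintro (i | i) <;> simp) hN₁ hN₂ h₁ h₂
    have h23 := hFs (Sum.elim (fun k => X (Sum.inr (Sum.inl k))) (fun k => X (Sum.inr (Sum.inr k))))
      (by rintro (i | i) <;> simp) hN₂ hN₃ h₂ h₃
    have hc12 : ∀ k, constantCoeff ((F k).subst (Sum.elim (fun k => X (Sum.inl k))
        (fun k => X (Sum.inr (Sum.inl k))) : Fin d ⊕ Fin d →
          MvPowerSeries (Fin d ⊕ (Fin d ⊕ Fin d)) (R p))) = 0 := fun k =>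
      constantCoeff_subst_eq_zero (hasSubst_of_constantCoeff_zero (by rintro (i | i) <;> simp))
        (by rintro (i | i) <;> simp) (hF0 k)
    have hc23 : ∀ k, constantCoeff ((F k).subst (Sum.elim (fun k => X (Sum.inr (Sum.inl k)))
        (fun k => X (Sum.inr (Sum.inr k))) : Fin d ⊕ Fin d →
          MvPowerSeries (Fin d ⊕ (Fin d ⊕ Fin d)) (R p))) = 0 := fun k =>
      constantCoeff_subst_eq_zero (hasSubst_of_constantCoeff_zero (by rintro (i | i) <;> simp))
        (by rintro (i | i) <;> simp) (hF0 k)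
    rw [hFs _ (by rintro (i | i); exacts [hc12 i, by simp]) (N₁ := N₁ * N₂)
        (by rw [Matrix.det_mul, hN₁, hN₂, one_mul]) hN₃
        (fun k => by simp only [Sum.elim_inl]; rw [h12]; ring) h₃,
      hFs _ (by rintro (i | i); exacts [by simp, hc23 i]) hN₁ (N₂ := N₂ * N₃)
        (by rw [Matrix.det_mul, hN₂, hN₃, one_mul]) h₁
        (fun k => by simp only [Sum.elim_inr]; rw [h23]; ring), Matrix.mul_assoc]
  · intro v w x y hv hw hx hy hxv hyw k
    obtain ⟨Ψ, hΨ, hΨX⟩ := exists_eval (Sum.elim v w) (by rintro (i | i); exacts [hv i, hw i])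
    have := hF Ψ.toRingHom hx hy (fun k => by rw [hxv]; simp [hΨX])
      (fun k => by rw [hyw]; simp [hΨX]) k
    rw [← this]
    exact hΨ _

end FormalGroup

/-! ### Congruence subgroups -/

section Congruence

variable {p n : ℕ} [Fact p.Prime]

/-- Reduction of `SL_n(𝔽_p[[t]])` modulo `t^(k+1)`. -/
noncomputable def SL.reduction (n p : ℕ) [Fact p.Prime] (k : ℕ) :
    SL n p →* Matrix.SpecialLinearGroup (Fin n) (R p ⧸ 𝔪 p ^ (k + 1)) :=
  Matrix.SpecialLinearGroup.map (Ideal.Quotient.mk (𝔪 p ^ (k + 1)))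

/-- The congruence subgroup of the matrices that are trivial modulo `t^(k+1)`. The exponent is
shifted because only the groups of level at least one are used. -/
noncomputable def SL.congruence (n p : ℕ) [Fact p.Prime] (k : ℕ) : Subgroup (SL n p) :=
  (SL.reduction n p k).ker

instance (k : ℕ) : (SL.congruence n p k).Normal := MonoidHom.normal_ker _

theorem SL.reduction_eq_iff {k : ℕ} {x y : SL n p} :
    SL.reduction n p k x = SL.reduction n p k y ↔ ∀ i j, x.1 i j - y.1 i j ∈ 𝔪 p ^ (k + 1) := by
  rw [Matrix.SpecialLinearGroup.ext_iff]
  simp only [SL.reduction, Matrix.SpecialLinearGroup.map_apply_coe, RingHom.mapMatrix_apply,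
    Matrix.map_apply, Ideal.Quotient.eq]

theorem SL.mem_congruence {k : ℕ} {x : SL n p} :
    x ∈ SL.congruence n p k ↔
      ∀ i j, x.1 i j - (1 : Matrix (Fin n) (Fin n) (R p)) i j ∈ 𝔪 p ^ (k + 1) := by
  rw [SL.congruence, MonoidHom.mem_ker, ← map_one (SL.reduction n p k), SL.reduction_eq_iff]
  rfl

theorem SL.mem_congruence_zero {x : SL n p} : x ∈ SL.congruence n p 0 ↔
    ∀ i j, x.1 i j - (1 : Matrix (Fin n) (Fin n) (R p)) i j ∈ 𝔪 p := by
  rw [SL.mem_congruence, zero_add, pow_one]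

theorem SL.congruence_antitone : Antitone (SL.congruence n p) := fun a b hab x hx => by
  rw [SL.mem_congruence] at hx ⊢
  exact fun i j => Ideal.pow_le_pow_right (by omega) (hx i j)

theorem SL.continuous_entry {p n : ℕ} (i j : Fin n) : Continuous fun x : SL n p => x.1 i j :=
  (continuous_apply j).comp ((continuous_apply i).comp continuous_subtype_val)

theorem SL.continuous_entry_sub_one (i j : Fin n) :
    Continuous fun x : SL n p => x.1 i j - (1 : Matrix (Fin n) (Fin n) (R p)) i j :=
  (SL.continuous_entry i j).sub continuous_const

theorem SL.isClosed_congruence (k : ℕ) : IsClosed (SL.congruence n p k : Set (SL n p)) := by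
  have : (SL.congruence n p k : Set (SL n p)) = ⋂ i, ⋂ j,
      {x | x.1 i j - (1 : Matrix (Fin n) (Fin n) (R p)) i j ∈ 𝔪 p ^ (k + 1)} := by
    ext x; simp [SL.mem_congruence]
  rw [this]
  exact isClosed_iInter fun i => isClosed_iInter fun j =>
    (isClosed_maximalIdeal_pow _).preimage (SL.continuous_entry_sub_one i j)

theorem SL.isOpen_congruence (k : ℕ) : IsOpen (SL.congruence n p k : Set (SL n p)) := by
  have : (SL.congruence n p k : Set (SL n p)) = ⋂ i, ⋂ j,
      {x | x.1 i j - (1 : Matrix (Fin n) (Fin n) (R p)) i j ∈ 𝔪 p ^ (k + 1)} := by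
    ext x; simp [SL.mem_congruence]
  rw [this]
  exact isOpen_iInter_of_finite fun i => isOpen_iInter_of_finite fun j =>
    (isOpen_maximalIdeal_pow _).preimage (SL.continuous_entry_sub_one i j)

theorem SL.exists_congruence_subset {U : Set (SL n p)} (hU : IsOpen U) (h1 : 1 ∈ U) :
    ∃ k, (SL.congruence n p k : Set (SL n p)) ⊆ U := by
  refine exists_subset_nhds_of_isCompact' (V := fun k => (SL.congruence n p k : Set (SL n p)))
    (directed_of_isDirected_le fun a b hab => SL.congruence_antitone hab)
    (fun k => (SL.isClosed_congruence k).isCompact) (fun k => SL.isClosed_congruence k) ?_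
  intro x hx
  have : x = 1 := by
    ext i j m
    have := SL.mem_congruence.1 (Set.mem_iInter.1 hx m) i j
    have h2 := mem_maximalIdeal_pow.1 this m (Nat.lt_succ_self m)
    rw [map_sub, sub_eq_zero] at h2
    exact h2
  exact this ▸ hU.mem_nhds h1

theorem isUnit_of_sub_one_mem {a : R p} (h : a - 1 ∈ 𝔪 p) : IsUnit a := by
  by_contra ha
  have h1 : a ∈ 𝔪 p := ha
  exact (IsLocalRing.maximalIdeal.isMaximal (R p)).ne_top
    ((Ideal.eq_top_iff_one _).2 (by simpa using sub_mem h1 h))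

theorem isUnit_adjugate_of_sub_one_mem {M : Matrix (Fin n) (Fin n) (R p)}
    (h : ∀ i j, M i j - (1 : Matrix (Fin n) (Fin n) (R p)) i j ∈ 𝔪 p) (l : Fin n) :
    IsUnit (M.adjugate l l) := by
  have h1 : M.map (Ideal.Quotient.mk (𝔪 p)) = 1 := by
    rw [← Matrix.map_one (Ideal.Quotient.mk (𝔪 p)) (map_zero _) (map_one _)]
    ext i j
    exact Ideal.Quotient.eq.2 (h i j)
  refine isUnit_of_sub_one_mem (Ideal.Quotient.eq.1 ?_)
  have h2 : Ideal.Quotient.mk (𝔪 p) (M.adjugate l l) =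
      (M.map (Ideal.Quotient.mk (𝔪 p))).adjugate l l := by
    rw [← RingHom.mapMatrix_apply, ← RingHom.map_adjugate]; rfl
  rw [h2, h1]
  simp

variable {l : Fin n}

theorem SL.eq_of_eq_off_corner {x y : SL n p} (hx : x ∈ SL.congruence n p 0)
    (h : ∀ i j, (i, j) ≠ (l, l) → x.1 i j = y.1 i j) : x = y :=
  Subtype.ext (StandardHausdorff.eq_of_eq_off_corner x.2 y.2
    (isUnit_adjugate_of_sub_one_mem (SL.mem_congruence_zero.1 hx) l) h)

theorem SL.reduction_eq_of_off_corner {x y : SL n p} {k : ℕ} (hx : x ∈ SL.congruence n p 0)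
    (h : ∀ i j, (i, j) ≠ (l, l) → x.1 i j - y.1 i j ∈ 𝔪 p ^ (k + 1)) :
    SL.reduction n p k x = SL.reduction n p k y := by
  refine Subtype.ext (StandardHausdorff.eq_of_eq_off_corner (SL.reduction n p k x).2
    (SL.reduction n p k y).2 (l := l) ?_ fun i j hij => Ideal.Quotient.eq.2 (h i j hij))
  have : (SL.reduction n p k x).1.adjugate l l =
      Ideal.Quotient.mk (𝔪 p ^ (k + 1)) (x.1.adjugate l l) := by
    change (RingHom.mapMatrix _ x.1).adjugate l l = _
    rw [← RingHom.map_adjugate]; rfl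
  rw [this]
  exact (isUnit_adjugate_of_sub_one_mem (SL.mem_congruence_zero.1 hx) l).map _

/-- The entries off the corner of a matrix in the first congruence subgroup can be prescribed. -/
theorem SL.exists_mem_congruence_zero (v : Fin n → Fin n → R p) (hv : ∀ i j, (i, j) ≠ (l, l) →
      v i j - (1 : Matrix (Fin n) (Fin n) (R p)) i j ∈ 𝔪 p) :
    ∃ x ∈ SL.congruence n p 0, ∀ i j, (i, j) ≠ (l, l) → x.1 i j = v i j := by
  classical
  let M : Matrix (Fin n) (Fin n) (R p) := fun i j => if (i, j) = (l, l) then 1 else v i j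
  have hM : ∀ i j, M i j - (1 : Matrix (Fin n) (Fin n) (R p)) i j ∈ 𝔪 p := by
    intro i j
    by_cases hij : (i, j) = (l, l)
    · obtain ⟨h2, h3⟩ : i = l ∧ j = l := Prod.ext_iff.1 hij
      rw [h2, h3, show M l l = 1 from if_pos rfl, Matrix.one_apply_eq, sub_self]
      exact zero_mem _
    · simpa only [M, if_neg hij] using hv i j hij
  obtain ⟨M', hM', hMM⟩ := exists_det_eq_one_of_isUnit_adjugate
    (isUnit_adjugate_of_sub_one_mem hM l)
  refine ⟨⟨M', hM'⟩, SL.mem_congruence_zero.2 fun i j => Ideal.Quotient.eq.1 ?_, fun i j hij => ?_⟩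
  · have h1 : (1 : Matrix (Fin n) (Fin n) (R p ⧸ 𝔪 p)) = M'.map (Ideal.Quotient.mk (𝔪 p)) := by
      refine StandardHausdorff.eq_of_eq_off_corner (l := l) (by simp) ?_ (by simp) fun i j hij => ?_
      · rw [← RingHom.mapMatrix_apply, ← RingHom.map_det, hM', map_one]
      · rw [Matrix.map_apply, ← hMM i j hij,
          ← Matrix.map_one (Ideal.Quotient.mk (𝔪 p)) (map_zero _) (map_one _)]
        exact (Ideal.Quotient.eq.2 (hM i j)).symm
    have h2 := congrFun (congrFun h1 i) j
    rw [← Matrix.map_one (Ideal.Quotient.mk (𝔪 p)) (map_zero _) (map_one _)] at h2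
    exact h2.symm
  · change M' i j = v i j
    rw [← hMM i j hij]
    simp only [M, if_neg hij]

end Congruence

/-! ### A standard subgroup of `SL_n` -/

section Chart

variable {p n : ℕ} [Fact p.Prime]

/-- The first congruence subgroup is standard of level one: its entries off the corner `(l, l)`,
minus those of the identity matrix, form a global chart. -/
theorem SL.nonempty_standardSubgroup (l : Fin n) : Nonempty (StandardSubgroup (SL.entries n p)) := by
  classical
  let d := Fintype.card {ij : Fin n × Fin n // ij ≠ (l, l)}
  let ε : Fin d ≃ {ij : Fin n × Fin n // ij ≠ (l, l)} := (Fintype.equivFin _).symm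
  have hε : ∀ {i j : Fin n}, (i, j) ≠ (l, l) → ∃ k, (ε k).1.1 = i ∧ (ε k).1.2 = j := by
    intro i j hij
    obtain ⟨k, hk⟩ := ε.surjective ⟨(i, j), hij⟩
    exact ⟨k, by rw [hk], by rw [hk]⟩
  let c : SL.congruence n p 0 → Polydisc p 1 (Fin d) := fun x =>
    ⟨fun k => x.1.1 (ε k).1.1 (ε k).1.2 - (1 : Matrix (Fin n) (Fin n) (R p)) (ε k).1.1 (ε k).1.2,
      fun k => SL.mem_congruence.1 x.2 _ _⟩
  have hc : ∀ (x : SL.congruence n p 0) k, x.1.1 (ε k).1.1 (ε k).1.2 =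
      (1 : Matrix (Fin n) (Fin n) (R p)) (ε k).1.1 (ε k).1.2 + (c x).1 k := fun x k => by simp [c]
  have hcm : ∀ (x : SL.congruence n p 0) k, (c x).1 k ∈ 𝔪 p := fun x k =>
    SL.mem_congruence_zero.1 x.2 _ _
  have hinj : Function.Injective c := by
    intro x y hxy
    refine Subtype.ext (SL.eq_of_eq_off_corner (l := l) x.2 fun i j hij => ?_)
    obtain ⟨k, rfl, rfl⟩ := hε hij
    rw [hc, hc, hxy]
  have hsurj : Function.Surjective c := by
    intro v
    obtain ⟨x, hx, hxv⟩ := SL.exists_mem_congruence_zero (l := l)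
      (fun i j => (1 : Matrix (Fin n) (Fin n) (R p)) i j +
        if h : (i, j) ≠ (l, l) then v.1 (ε.symm ⟨(i, j), h⟩) else 0) fun i j hij => by
          rw [dif_pos hij, add_sub_cancel_left]
          exact Ideal.pow_le_self one_ne_zero (v.2 _)
    refine ⟨⟨x, hx⟩, Subtype.ext (funext fun k => ?_)⟩
    have h1 := hxv _ _ (show ((ε k).1.1, (ε k).1.2) ≠ (l, l) from (ε k).2)
    rw [dif_pos (show ((ε k).1.1, (ε k).1.2) ≠ (l, l) from (ε k).2)] at h1
    simp only [c, h1, add_sub_cancel_left]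
    exact congrArg v.1 (ε.symm_apply_apply k)
  have hcont : Continuous c := by
    refine Continuous.subtype_mk (continuous_pi fun k => ?_) _
    exact (SL.continuous_entry_sub_one _ _).comp continuous_subtype_val
  have : CompactSpace (SL.congruence n p 0) :=
    isCompact_iff_compactSpace.1 (SL.isClosed_congruence 0).isCompact
  obtain ⟨F, hF⟩ := exists_formalGroupLaw (p := p) ε
  refine ⟨⟨SL.congruence n p 0, SL.isOpen_congruence 0, 1, le_rfl, d,
    Continuous.homeoOfEquivCompactToT2 (f := Equiv.ofBijective c ⟨hinj, hsurj⟩) hcont,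
    fun i => ?_, F, fun x y k => ?_, fun x => ?_, fun x => ?_⟩⟩
  · change (c 1).1 i = 0
    simp [c]
  · exact hF _ _ x.1.1 y.1.1 (hcm x) (hcm y) x.1.2 y.1.2 (hc x) (hc y) k
  · refine ⟨0, fun k => MvPowerSeries.X (ε k).1 + MvPowerSeries.C ((c x).1 k),
      fun y z hy hz k => ?_⟩
    obtain ⟨Ψ, hΨ, hΨX⟩ := exists_eval y hy
    have h1 := hΨ (MvPowerSeries.X (ε k).1 + MvPowerSeries.C ((c x).1 k))
    have h2 : Ψ (MvPowerSeries.X (ε k).1 + MvPowerSeries.C ((c x).1 k)) = (c z).1 k := by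
      have h3 : Ψ (MvPowerSeries.C ((c x).1 k)) = (c x).1 k := Ψ.commutes _
      have h4 := hz (ε k).1
      simp only [SL.entries, pow_zero, one_mul] at h4
      rw [map_add, hΨX, h3]
      simp only [c, h4]
      ring
    rw [h2] at h1
    exact h1
  · obtain ⟨M, hM, hu, hMk⟩ := exists_genericMatrix ε x.1.1
      (isUnit_adjugate_of_sub_one_mem (SL.mem_congruence_zero.1 x.2) l)
    refine ⟨0, fun ij => M ij.1 ij.2, fun y z hy hz ij => ?_⟩
    obtain ⟨Ψ, hΨ, hΨX⟩ := exists_eval y hy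
    have h1 : M.map Ψ.toRingHom = z.1.1 := by
      refine map_genericMatrix_eq ε hM hu hMk Ψ.toRingHom z.1.2 fun k => ?_
      have h3 : Ψ.toRingHom (MvPowerSeries.C (x.1.1 (ε k).1.1 (ε k).1.2)) = _ := Ψ.commutes _
      have h4 : Ψ.toRingHom (MvPowerSeries.X k) = y k := hΨX k
      have h5 : (c z).1 k = (c x).1 k + PowerSeries.X ^ 0 * y k := hz k
      rw [h3, h4, hc z, h5, pow_zero, one_mul, ← add_assoc, ← hc x]
      rfl
    have h2 : Ψ (M ij.1 ij.2) = SL.entries n p z.1 ij := congrFun (congrFun h1 ij.1) ij.2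
    have h6 := hΨ (M ij.1 ij.2)
    rw [h2] at h6
    exact h6

end Chart

/-! ### Comparison of standard filtrations with the congruence filtration -/

section Interlacing

variable {p n : ℕ} [Fact p.Prime]

theorem EvalsTo.zero_eq_constantCoeff {σ : Type*} {F : MvPowerSeries σ (R p)} {v : R p}
    (h : EvalsTo F 0 v) : v = F.constantCoeff := by
  refine HasSum.unique h ?_
  have h1 := hasSum_single (f := fun α : σ →₀ ℕ => MvPowerSeries.coeff α F *
    α.prod fun i k => (0 : σ → R p) i ^ k) 0 (fun α hα => ?_)
  · simpa using h1
  · obtain ⟨i, hi⟩ := Finsupp.support_nonempty_iff.2 hα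
    rw [Finsupp.prod, Finset.prod_eq_zero hi, mul_zero]
    simpa using hi

/-- Subtracting the constant term makes `EvalsTo.mem` applicable. -/
theorem EvalsTo.sub_mem {σ : Type*} {F : MvPowerSeries σ (R p)} {x : σ → R p} {v w : R p} {M : ℕ}
    (h : EvalsTo F x v) (h0 : EvalsTo F 0 w) (hx : ∀ i, x i ∈ 𝔪 p ^ M) : v - w ∈ 𝔪 p ^ M := by
  rw [h0.zero_eq_constantCoeff]
  refine EvalsTo.mem (F := F - MvPowerSeries.C F.constantCoeff) (x := x) ?_ (by simp) hx
  have h1 := hasSum_single (f := fun α : σ →₀ ℕ =>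
    MvPowerSeries.coeff α (MvPowerSeries.C (σ := σ) F.constantCoeff) *
    α.prod fun i k => x i ^ k) 0 (fun α hα => by
      classical
      rw [MvPowerSeries.coeff_C, if_neg hα, zero_mul])
  have h2 := h.sub h1
  simpa [EvalsTo, sub_mul] using h2

theorem exists_eq_X_pow_mul {N M : ℕ} {a : R p} (h : a ∈ 𝔪 p ^ (N + M)) :
    ∃ y ∈ 𝔪 p ^ M, a = PowerSeries.X ^ N * y := by
  rw [𝔪, PowerSeries.maximalIdeal_eq_span_X, Ideal.span_singleton_pow,
    Ideal.mem_span_singleton] at h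
  obtain ⟨b, rfl⟩ := h
  refine ⟨PowerSeries.X ^ M * b, ?_, by rw [pow_add, mul_assoc]⟩
  rw [𝔪, PowerSeries.maximalIdeal_eq_span_X, Ideal.span_singleton_pow, Ideal.mem_span_singleton]
  exact dvd_mul_right _ _

/-- An analytic function is locally Lipschitz: on points close to `z₀` it preserves congruences
up to a bounded shift. -/
theorem IsAnalyticIn.exists_sub_mem {Z ι κ : Type*} {e : Z → ι → R p} {g : Z → κ → R p}
    (h : IsAnalyticIn e g) (z₀ : Z) : ∃ N : ℕ, ∀ (k : ℕ) (z : Z),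
      (∀ i, e z i - e z₀ i ∈ 𝔪 p ^ (k + N)) → ∀ j, g z j - g z₀ j ∈ 𝔪 p ^ (k + 1) := by
  obtain ⟨N, F, hF⟩ := h z₀
  refine ⟨N + 1, fun k z hz j => ?_⟩
  choose y hy hyz using fun i =>
    exists_eq_X_pow_mul (N := N) (M := k + 1) (by rw [add_left_comm]; exact hz i)
  refine (hF y z (fun i => Ideal.pow_le_self (by omega) (hy i))
    (fun i => by rw [← hyz]; ring) j).sub_mem (hF 0 z₀ (fun i => zero_mem _) (by simp) j) hy

/-- Every standard filtration is interlaced with the congruence filtration. -/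
theorem SL.exists_interlacing (S : StandardSubgroup (SL.entries n p)) :
    ∃ c, (∀ k, SL.congruence n p (k + c) ≤ S.filtration.term k) ∧
      ∀ k, S.filtration.term (k + c) ≤ SL.congruence n p k := by
  obtain ⟨N₁, h₁⟩ := S.analytic_chart.exists_sub_mem 1
  obtain ⟨N₂, h₂⟩ := S.analytic_chart_symm.exists_sub_mem 1
  obtain ⟨k₀, hk₀⟩ := SL.exists_congruence_subset S.isOpen S.carrier.one_mem
  refine ⟨k₀ + S.level + N₁ + N₂, fun k x hx => ?_, fun k x hx => ?_⟩
  · have hxS : x ∈ S.carrier := hk₀ (SL.congruence_antitone (by omega) hx)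
    refine ⟨⟨x, hxS⟩, fun i => ?_, rfl⟩
    have := h₁ (k + S.level) ⟨x, hxS⟩ (fun ij =>
      Ideal.pow_le_pow_right (by omega) (SL.mem_congruence.1 hx ij.1 ij.2)) i
    rw [S.chart_one, sub_zero] at this
    exact Ideal.pow_le_pow_right (by omega) this
  · obtain ⟨z, hz, rfl⟩ := hx
    refine SL.mem_congruence.2 fun i j => h₂ k z (fun a => ?_) (i, j)
    rw [S.chart_one, sub_zero]
    exact Ideal.pow_le_pow_right (by omega) (hz a)

end Interlacing

/-! ### Counting residue classes -/

section ResidueCount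

variable {p : ℕ} [Fact p.Prime]

/-- The number of residue classes modulo `t^(k+1)` met by a set of power series. -/
noncomputable def residueCount (T : Set (R p)) (k : ℕ) : ℕ :=
  (Ideal.Quotient.mk (𝔪 p ^ (k + 1)) '' T).ncard

theorem sub_mem_maximalIdeal_pow_iff {f g : R p} {k : ℕ} :
    f - g ∈ 𝔪 p ^ k ↔ ∀ i < k, PowerSeries.coeff i f = PowerSeries.coeff i g := by
  simp only [mem_maximalIdeal_pow, map_sub, sub_eq_zero]

theorem residueCount_singleton (a : R p) (k : ℕ) : residueCount {a} k = 1 := by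
  simp [residueCount]

/-- If the elements of `T` are parametrised modulo `t^(k+1)` by their coefficients at the positions in
`F`, which can be prescribed arbitrarily, then `T` meets `p^|F|` residue classes. -/
theorem residueCount_eq_pow {T : Set (R p)} {k : ℕ} (F : Finset ℕ) (hF : ∀ i ∈ F, i ≤ k)
    (hsurj : ∀ b : ℕ → ZMod p, ∃ f ∈ T, ∀ i ∈ F, PowerSeries.coeff i f = b i)
    (hinj : ∀ f ∈ T, ∀ g ∈ T, (∀ i ∈ F, PowerSeries.coeff i f = PowerSeries.coeff i g) →
      ∀ i ≤ k, PowerSeries.coeff i f = PowerSeries.coeff i g) :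
    residueCount T k = p ^ F.card := by
  have hmk : ∀ {f g : R p}, Ideal.Quotient.mk (𝔪 p ^ (k + 1)) f = Ideal.Quotient.mk _ g ↔
      ∀ i ≤ k, PowerSeries.coeff i f = PowerSeries.coeff i g := by
    intro f g
    rw [Ideal.Quotient.eq, sub_mem_maximalIdeal_pow_iff]
    simp only [Nat.lt_succ_iff]
  choose f hfT hf using fun b : F → ZMod p => hsurj fun i => if h : i ∈ F then b ⟨i, h⟩ else 0
  have hf' : ∀ b (i : F), PowerSeries.coeff i.1 (f b) = b i := fun b i => by
    rw [hf b i.1 i.2, dif_pos i.2]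
  let φ : (F → ZMod p) → Ideal.Quotient.mk (𝔪 p ^ (k + 1)) '' T := fun b => ⟨_, f b, hfT b, rfl⟩
  have hφ : Function.Bijective φ := by
    constructor
    · intro b c hbc
      have := hmk.1 (congrArg Subtype.val hbc)
      funext i
      rw [← hf' b, ← hf' c, this i (hF i i.2)]
    · rintro ⟨_, g, hg, rfl⟩
      refine ⟨fun i => PowerSeries.coeff i.1 g, Subtype.ext (hmk.2 (hinj _ (hfT _) _ hg fun i hi => ?_))⟩
      rw [hf' _ ⟨i, hi⟩]
  rw [residueCount, ← Nat.card_coe_set_eq, ← Nat.card_congr (Equiv.ofBijective φ hφ),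
    Nat.card_fun, Nat.card_zmod, Nat.card_eq_fintype_card, Fintype.card_coe]

theorem residueCount_coset (a : R p) (k : ℕ) : residueCount {f : R p | f - a ∈ 𝔪 p} k = p ^ k := by
  have hmem : ∀ f : R p, f - a ∈ 𝔪 p ↔ PowerSeries.coeff 0 f = PowerSeries.coeff 0 a := fun f => by
    rw [← pow_one (𝔪 p), sub_mem_maximalIdeal_pow_iff]
    simp
  rw [residueCount_eq_pow (Finset.Icc 1 k) (fun i hi => (Finset.mem_Icc.1 hi).2)]
  · simp
  · intro b
    refine ⟨PowerSeries.mk fun i => if i = 0 then PowerSeries.coeff 0 a else b i, ?_, fun i hi => ?_⟩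
    · rw [Set.mem_ofPred_eq, hmem]
      simp
    · have := (Finset.mem_Icc.1 hi).1
      rw [PowerSeries.coeff_mk, if_neg (by omega)]
  · intro f hf g hg h i hi
    rcases Nat.eq_zero_or_pos i with rfl | hi0
    · rw [(hmem f).1 hf, (hmem g).1 hg]
    · exact h i (Finset.mem_Icc.2 ⟨hi0, hi⟩)

/-- In characteristic `p`, raising to the power `q = p^j` multiplies the precision by `q`. -/
theorem residueCount_image_pow (T : Set (R p)) (j k : ℕ) :
    residueCount ((· ^ p ^ j) '' T) k = residueCount T (k / p ^ j) := by
  have hp : 0 < p ^ j := pow_pos (Fact.out : p.Prime).pos j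
  have key : ∀ f g : R p, f ^ p ^ j - g ^ p ^ j ∈ 𝔪 p ^ (k + 1) ↔
      f - g ∈ 𝔪 p ^ (k / p ^ j + 1) := by
    intro f g
    have : CharP (R p) p := charP_of_injective_algebraMap
      (algebraMap (ZMod p) (R p)).injective p
    rw [← sub_pow_char_pow]
    have hord : ∀ (h : R p) (s : ℕ), h ∈ 𝔪 p ^ s ↔ (s : ℕ∞) ≤ h.order := by
      intro h s
      rw [mem_maximalIdeal_pow]
      exact ⟨PowerSeries.nat_le_order _ _, fun hs i hi =>
        PowerSeries.coeff_of_lt_order _ (lt_of_lt_of_le (by exact_mod_cast hi) hs)⟩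
    rw [hord, hord, PowerSeries.order_pow]
    rcases eq_or_ne (f - g) 0 with h0 | h0
    · rw [h0, PowerSeries.order_zero]
      simp [nsmul_eq_mul, ENat.mul_top (show ((p : ℕ∞) ^ j) ≠ 0 by exact_mod_cast hp.ne')]
    · rw [← PowerSeries.coe_toNat_order h0, nsmul_eq_mul]
      norm_cast
      rw [Nat.succ_le_iff, Nat.succ_le_iff, Nat.div_lt_iff_lt_mul hp, mul_comm]
  rw [residueCount, residueCount, ← Nat.card_coe_set_eq, ← Nat.card_coe_set_eq]
  let φ : T → Ideal.Quotient.mk (𝔪 p ^ (k + 1)) '' ((· ^ p ^ j) '' T) := fun f =>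
    ⟨_, _, ⟨f.1, f.2, rfl⟩, rfl⟩
  let ψ : T → Ideal.Quotient.mk (𝔪 p ^ (k / p ^ j + 1)) '' T := fun f => ⟨_, f.1, f.2, rfl⟩
  have hφ : Function.Surjective φ := by rintro ⟨_, _, ⟨f, hf, rfl⟩, rfl⟩; exact ⟨⟨f, hf⟩, rfl⟩
  have hψ : Function.Surjective ψ := by rintro ⟨_, f, hf, rfl⟩; exact ⟨⟨f, hf⟩, rfl⟩
  have hker : ∀ f g, φ f = φ g ↔ ψ f = ψ g := fun f g => by
    rw [Subtype.ext_iff, Subtype.ext_iff]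
    exact Ideal.Quotient.eq.trans ((key f.1 g.1).trans Ideal.Quotient.eq.symm)
  refine Nat.card_congr (Equiv.ofBijective (fun y => ψ (hφ y).choose) ⟨fun y z h => ?_, fun z => ?_⟩)
  · have h1 := (hker _ _).2 h
    rwa [(hφ y).choose_spec, (hφ z).choose_spec] at h1
  · obtain ⟨f, rfl⟩ := hψ z
    exact ⟨φ f, (hker _ _).1 (hφ (φ f)).choose_spec⟩

theorem isClosed_of_forall_sub_mem {T : Set (R p)}
    (h : ∀ f, (∀ k, ∃ g ∈ T, g - f ∈ 𝔪 p ^ k) → f ∈ T) : IsClosed T := by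
  refine isClosed_of_closure_subset fun f hf => h f fun k => ?_
  obtain ⟨g, hg, hgT⟩ := mem_closure_iff.1 hf {g | g - f ∈ 𝔪 p ^ k}
    ((isOpen_maximalIdeal_pow k).preimage (continuous_id.sub continuous_const)) (by simp)
  exact ⟨g, hgT, hg⟩

end ResidueCount

/-! ### Multiplicative groups defined by the logarithmic derivative -/

section LogDerivative

variable {p : ℕ} [Fact p.Prime]

/-- The logarithmic derivative `t f' / f` of a power series. -/
noncomputable def logDeriv (f : R p) : R p := PowerSeries.X * PowerSeries.derivative (ZMod p) f * f⁻¹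

theorem logDeriv_one : logDeriv (1 : R p) = 0 := by
  simp [logDeriv]

theorem logDeriv_mul {f g : R p} (hf : f.constantCoeff = 1) (hg : g.constantCoeff = 1) :
    logDeriv (f * g) = logDeriv f + logDeriv g := by
  have h1 : f * f⁻¹ = 1 := PowerSeries.mul_inv_cancel f (by simp [hf])
  have h2 : g * g⁻¹ = 1 := PowerSeries.mul_inv_cancel g (by simp [hg])
  simp only [logDeriv, Derivation.leibniz, smul_eq_mul, PowerSeries.mul_inv_rev]
  linear_combination (PowerSeries.X * PowerSeries.derivative (ZMod p) f * f⁻¹) * h2 +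
    (PowerSeries.X * PowerSeries.derivative (ZMod p) g * g⁻¹) * h1

/-- The logarithmic derivative is triangular: its `i`-th coefficient depends on the `i`-th
coefficient of the series with slope `i`, which is invertible if `p` does not divide `i`. -/
theorem coeff_logDeriv_sub {f g : R p} (hg : g.constantCoeff = 1)
    {i : ℕ} (hi : i ≠ 0) (h : ∀ j < i, PowerSeries.coeff j f = PowerSeries.coeff j g) :
    PowerSeries.coeff i (logDeriv f) - PowerSeries.coeff i (logDeriv g) =
      i * (PowerSeries.coeff i f - PowerSeries.coeff i g) := by
  have hgg : g * g⁻¹ = 1 := PowerSeries.mul_inv_cancel g (by simp [hg])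
  have hgc : (g⁻¹).constantCoeff = 1 := by simp [hg]
  obtain ⟨v, hv⟩ : PowerSeries.X ^ i ∣ f - g :=
    PowerSeries.X_pow_dvd_iff.2 fun j hj => by rw [map_sub, h j hj, sub_self]
  have hvc : v.constantCoeff = PowerSeries.coeff i f - PowerSeries.coeff i g := by
    rw [← map_sub, hv]
    simpa using (PowerSeries.coeff_X_pow_mul v i 0).symm
  set w := v * g⁻¹ with hw
  set u := 1 + PowerSeries.X ^ i * w with hu
  -- With `f = g u`, the difference in question is the coefficient of `logDeriv u`.
  have hfu : f = g * u := by
    rw [hu, hw]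
    linear_combination hv - PowerSeries.X ^ i * v * hgg
  have huc : u.constantCoeff = 1 := by simp [hu, hi]
  have hder : PowerSeries.X * PowerSeries.derivative (ZMod p) u =
      PowerSeries.X ^ i * ((i : R p) * w + PowerSeries.X * PowerSeries.derivative (ZMod p) w) := by
    obtain ⟨i, rfl⟩ := Nat.exists_eq_succ_of_ne_zero hi
    rw [hu, map_add, PowerSeries.derivative_one, Derivation.leibniz, PowerSeries.derivative_pow,
      PowerSeries.derivative_X]
    simp only [smul_eq_mul, Nat.succ_eq_add_one, Nat.add_sub_cancel]
    ring
  rw [hfu, logDeriv_mul hg huc, map_add, add_sub_cancel_left, ← hfu, ← hvc, logDeriv, hder, mul_assoc]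
  have := PowerSeries.coeff_X_pow_mul (((i : R p) * w + PowerSeries.X *
    PowerSeries.derivative (ZMod p) w) * u⁻¹) i 0
  rw [zero_add] at this
  rw [this]
  simp [huc, hw, hgc]

/-- The multiplicative group of power series with constant term one such that the coefficients
of the logarithmic derivative at the positions in `E` vanish. -/
noncomputable def logDerivSubmonoid (p : ℕ) [Fact p.Prime] (E : Set ℕ) : Submonoid (R p) where
  carrier := {f | f.constantCoeff = 1 ∧ ∀ i ∈ E, PowerSeries.coeff i (logDeriv f) = 0}
  one_mem' := ⟨by simp, fun i _ => by simp [logDeriv_one]⟩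
  mul_mem' := fun hf hg => ⟨by simp [hf.1, hg.1], fun i hi => by
    rw [logDeriv_mul hf.1 hg.1, map_add, hf.2 i hi, hg.2 i hi, add_zero]⟩

variable {E : Set ℕ}

theorem isClosed_logDerivSubmonoid (hE : ∀ i ∈ E, ¬ p ∣ i) :
    IsClosed (logDerivSubmonoid p E : Set (R p)) := by
  refine isClosed_of_forall_sub_mem fun f hf => ?_
  have hf0 : f.constantCoeff = 1 := by
    obtain ⟨g, hg, hgf⟩ := hf 1
    have := sub_mem_maximalIdeal_pow_iff.1 hgf 0 one_pos
    rw [PowerSeries.coeff_zero_eq_constantCoeff_apply,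
      PowerSeries.coeff_zero_eq_constantCoeff_apply] at this
    rw [← this, hg.1]
  refine ⟨hf0, fun i hi => ?_⟩
  have hi0 : i ≠ 0 := by rintro rfl; exact hE 0 hi (dvd_zero p)
  obtain ⟨g, hg, hgf⟩ := hf (i + 1)
  rw [sub_mem_maximalIdeal_pow_iff] at hgf
  have := coeff_logDeriv_sub hf0 hi0 fun j hj => hgf j (by omega)
  rw [hg.2 i hi, hgf i (by omega)] at this
  simpa using this

theorem exists_inv_logDerivSubmonoid {f : R p} (hf : f ∈ logDerivSubmonoid p E) :
    ∃ g ∈ logDerivSubmonoid p E, f * g = 1 := by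
  have h1 : f * f⁻¹ = 1 := PowerSeries.mul_inv_cancel f (by simp [hf.1])
  have h2 : (f⁻¹).constantCoeff = 1 := by simp [hf.1]
  refine ⟨f⁻¹, ⟨h2, fun i hi => ?_⟩, h1⟩
  have := congrArg (PowerSeries.coeff i) (logDeriv_mul hf.1 h2)
  rw [h1, logDeriv_one, map_add, hf.2 i hi, zero_add, map_zero] at this
  exact this.symm

/-- Sequences can be defined recursively in terms of their truncations. -/
theorem exists_eq_of_truncated {α : Type*} [Zero α] (Φ : ℕ → (ℕ → α) → α) :
    ∃ a : ℕ → α, ∀ i, a i = Φ i fun j => if j < i then a j else 0 := by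
  classical
  let a : ℕ → α := WellFoundedLT.fix (motive := fun _ => α)
    fun i ih => Φ i fun j => if h : j < i then ih j h else 0
  refine ⟨a, fun i => ?_⟩
  have := WellFoundedLT.fix_eq (motive := fun _ => α)
    (fun i ih => Φ i fun j => if h : j < i then ih j h else 0) i
  simpa only [dite_eq_ite] using this

/-- The coefficients outside `E` of an element of `logDerivSubmonoid p E` can be prescribed. -/
theorem exists_mem_logDerivSubmonoid (hE : ∀ i ∈ E, ¬ p ∣ i) (b : ℕ → ZMod p) :
    ∃ f ∈ logDerivSubmonoid p E, ∀ i, i ≠ 0 → i ∉ E → PowerSeries.coeff i f = b i := by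
  classical
  obtain ⟨a, ha⟩ := exists_eq_of_truncated fun i (t : ℕ → ZMod p) =>
    if i = 0 then 1 else if i ∈ E then
      -((i : ZMod p)⁻¹ * PowerSeries.coeff i (logDeriv (PowerSeries.mk t))) else b i
  have h0 : a 0 = 1 := by rw [ha]; simp
  refine ⟨PowerSeries.mk a, ⟨by simp [h0], fun i hi => ?_⟩, fun i hi hiE => ?_⟩
  · have hi0 : i ≠ 0 := by rintro rfl; exact hE 0 hi (dvd_zero p)
    have hip : (i : ZMod p) ≠ 0 := by rw [Ne, ZMod.natCast_eq_zero_iff]; exact hE i hi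
    set t : ℕ → ZMod p := fun j => if j < i then a j else 0 with ht
    have h1 := coeff_logDeriv_sub (f := PowerSeries.mk a) (g := PowerSeries.mk t) (i := i)
      (by simp [ht, h0, Nat.pos_of_ne_zero hi0]) hi0
      (fun j hj => by simp [ht, hj])
    have h2 := ha i
    rw [if_neg hi0, if_pos hi] at h2
    rw [PowerSeries.coeff_mk, PowerSeries.coeff_mk, h2, show t i = 0 by simp [ht], sub_zero,
      mul_neg, mul_inv_cancel_left₀ hip] at h1
    linear_combination h1
  · rw [PowerSeries.coeff_mk, ha, if_neg hi, if_neg hiE]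

open Classical in
theorem residueCount_logDerivSubmonoid (hE : ∀ i ∈ E, ¬ p ∣ i) (k : ℕ) :
    residueCount (logDerivSubmonoid p E : Set (R p)) k =
      p ^ ((Finset.Icc 1 k).filter (· ∉ E)).card := by
  refine residueCount_eq_pow _ (fun i hi => ?_) (fun b => ?_) fun f hf g hg h i hi => ?_
  · exact (Finset.mem_Icc.1 (Finset.mem_filter.1 hi).1).2
  · obtain ⟨f, hf, hfb⟩ := exists_mem_logDerivSubmonoid hE b
    refine ⟨f, hf, fun i hi => ?_⟩
    rw [Finset.mem_filter, Finset.mem_Icc] at hi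
    exact hfb i (by omega) hi.2
  · induction i using Nat.strong_induction_on with
    | _ i ih =>
      rcases Nat.eq_zero_or_pos i with rfl | hi0
      · simp [hf.1, hg.1]
      by_cases hiE : i ∈ E
      · have hip : (i : ZMod p) ≠ 0 := by rw [Ne, ZMod.natCast_eq_zero_iff]; exact hE i hiE
        have h1 := coeff_logDeriv_sub hg.1 hi0.ne' fun j hj => ih j hj (by omega)
        rw [hf.2 i hiE, hg.2 i hiE, sub_self, eq_comm, mul_eq_zero, sub_eq_zero] at h1
        exact h1.resolve_left hip
      · exact h i (Finset.mem_filter.2 ⟨Finset.mem_Icc.2 ⟨hi0, hi⟩, hiE⟩)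

end LogDerivative

/-! ### Thinning out sets of integers -/

section Density

/-- The second summand is `⌈N / p⌉`, the number of multiples of `p` below `N`. -/
theorem count_not_dvd_add (p N : ℕ) (hp : 0 < p) :
    Nat.count (fun i => ¬ p ∣ i) N + (N + (p - 1)) / p = N := by
  induction N with
  | zero => simp [Nat.div_eq_of_lt (show p - 1 < p by omega)]
  | succ N ih =>
    rw [Nat.count_succ, show N + 1 + (p - 1) = N + (p - 1) + 1 by ring, Nat.succ_div,
      show N + (p - 1) + 1 = N + p by omega]
    simp only [Nat.dvd_add_self_right]
    split_ifs <;> omega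

theorem abs_count_not_dvd_sub_le (p N : ℕ) (hp : 0 < p) :
    |(Nat.count (fun i => ¬ p ∣ i) N : ℝ) - (1 - (p : ℝ)⁻¹) * N| ≤ 1 := by
  have hp' : (0 : ℝ) < p := by exact_mod_cast hp
  have h1 : (Nat.count (fun i => ¬ p ∣ i) N : ℝ) + ((N + (p - 1)) / p : ℕ) = N := by
    exact_mod_cast count_not_dvd_add p N hp
  have h2 := Nat.div_mul_le_self (N + (p - 1)) p
  have h3 := Nat.lt_succ_iff.1 (Nat.lt_succ_of_lt (Nat.lt_div_mul_add hp (a := N + (p - 1))))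
  set q := (N + (p - 1)) / p
  have h4 : (q : ℝ) * p ≤ N + p := by
    have : q * p ≤ N + p := by omega
    exact_mod_cast this
  have h5 : (N : ℝ) ≤ q * p + p := by
    have : N ≤ q * p + p := by omega
    exact_mod_cast this
  have h6 : (q : ℝ) ≤ (p : ℝ)⁻¹ * N + 1 := by
    rw [← le_div_iff₀ hp'] at h4
    refine h4.trans_eq ?_
    field_simp
  have h7 : (p : ℝ)⁻¹ * N ≤ q + 1 := by
    rw [inv_mul_le_iff₀ hp']
    linarith
  rw [abs_le]
  constructor <;> linarith

/-- Thinning out an infinite set of integers by a factor `γ`, with bounded discrepancy. -/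
theorem exists_subset_count_eq_floor (P : ℕ → Prop) [DecidablePred P] {γ : ℝ} (hγ0 : 0 ≤ γ)
    (hγ1 : γ ≤ 1) : ∃ E : Set ℕ, (∀ i ∈ E, P i) ∧ ∀ (_ : DecidablePred (· ∈ E)) (N : ℕ),
      Nat.count (· ∈ E) N = ⌊γ * Nat.count P N⌋₊ := by
  refine ⟨{i | P i ∧ ⌊γ * Nat.count P i⌋₊ < ⌊γ * (Nat.count P i + 1)⌋₊}, fun i hi => hi.1,
    fun hdec N => ?_⟩
  induction N with
  | zero => simp
  | succ N ih =>
    rw [Nat.count_succ, Nat.count_succ, ih]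
    by_cases hP : P N
    · have h1 : ⌊γ * (Nat.count P N + 1)⌋₊ ≤ ⌊γ * Nat.count P N⌋₊ + 1 := by
        rw [← Nat.floor_add_one (by positivity)]
        exact Nat.floor_le_floor (by linarith)
      have h2 : ⌊γ * Nat.count P N⌋₊ ≤ ⌊γ * (Nat.count P N + 1)⌋₊ :=
        Nat.floor_le_floor (by nlinarith)
      rw [if_pos hP]
      push_cast
      by_cases h3 : ⌊γ * Nat.count P N⌋₊ < ⌊γ * (Nat.count P N + 1)⌋₊
      · rw [if_pos ⟨hP, h3⟩]; omega
      · rw [if_neg fun h => h3 h.2]; omega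
    · rw [if_neg hP, if_neg fun h => hP h.1]
      simp

end Density

/-! ### Closed subgroups of `1 + t 𝔽_p[[t]]` of prescribed density -/

section TorusSubgroup

variable {p : ℕ} [Fact p.Prime]

theorem sub_one_mem_of_constantCoeff {f : R p} (hf : f.constantCoeff = 1) : f - 1 ∈ 𝔪 p := by
  rw [← pow_one (𝔪 p), sub_mem_maximalIdeal_pow_iff]
  intro i hi
  obtain rfl : i = 0 := by omega
  simp [hf]

open Classical in
/-- A set of integers prime to `p` whose complement has density `β`, with bounded discrepancy. -/
theorem exists_compl_density {β : ℝ} (h0 : (p : ℝ)⁻¹ ≤ β) (h1 : β ≤ 1) :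
    ∃ E : Set ℕ, (∀ i ∈ E, ¬ p ∣ i) ∧
      ∀ k, |(((Finset.Icc 1 k).filter (· ∉ E)).card : ℝ) - β * k| ≤ 3 := by
  have hp1 : 1 < p := (Fact.out : p.Prime).one_lt
  have hp1' : (1 : ℝ) < p := by exact_mod_cast hp1
  have hpi : (p : ℝ)⁻¹ < 1 := inv_lt_one_of_one_lt₀ hp1'
  have hδ : 0 < 1 - (p : ℝ)⁻¹ := by linarith
  -- The proportion `γ` of the integers prime to `p` has density `1 - β`.
  set γ : ℝ := (1 - β) / (1 - (p : ℝ)⁻¹) with hγ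
  have hγ0 : 0 ≤ γ := div_nonneg (by linarith) hδ.le
  have hγ1 : γ ≤ 1 := (div_le_one hδ).2 (by linarith)
  obtain ⟨E, hE, hcount⟩ := exists_subset_count_eq_floor (fun i => ¬ p ∣ i) hγ0 hγ1
  refine ⟨E, hE, fun k => ?_⟩
  have hE0 : 0 ∉ E := fun h => hE 0 h (dvd_zero p)
  have h2 : ((Finset.Icc 1 k).filter (· ∉ E)).card + Nat.count (· ∈ E) (k + 1) = k := by
    have h3 : (Finset.range (k + 1)).filter (· ∈ E) = (Finset.Icc 1 k).filter (· ∈ E) := by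
      ext i
      simp only [Finset.mem_filter, Finset.mem_range, Finset.mem_Icc]
      constructor
      · rintro ⟨h, hi⟩
        have : i ≠ 0 := by rintro rfl; exact hE0 hi
        exact ⟨by omega, hi⟩
      · rintro ⟨h, hi⟩
        exact ⟨by omega, hi⟩
    rw [Nat.count_eq_card_filter_range, h3, add_comm,
      Finset.card_filter_add_card_filter_not]
    simp
  rw [hcount] at h2
  have h3 : (((Finset.Icc 1 k).filter (· ∉ E)).card : ℝ) +
      ⌊γ * Nat.count (fun i => ¬ p ∣ i) (k + 1)⌋₊ = k := by exact_mod_cast h2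
  have h4 := Nat.floor_le (show 0 ≤ γ * Nat.count (fun i => ¬ p ∣ i) (k + 1) by positivity)
  have h5 := Nat.lt_floor_add_one (γ * Nat.count (fun i => ¬ p ∣ i) (k + 1))
  have h6 := abs_le.1 (abs_count_not_dvd_sub_le p (k + 1) (by omega))
  push_cast at h6
  have h7 : γ * ((1 - (p : ℝ)⁻¹) * (k + 1)) = (1 - β) * (k + 1) := by
    rw [← mul_assoc, hγ, div_mul_cancel₀ _ hδ.ne']
  have hβ : 0 ≤ β := h0.trans' (by positivity)
  rw [abs_le]
  constructor <;> nlinarith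

/-- The group of power series with constant term one has closed subgroups of every density. -/
theorem exists_submonoid_growth {β : ℝ} (h0 : 0 ≤ β) (h1 : β ≤ 1) :
    ∃ T : Submonoid (R p), IsClosed (T : Set (R p)) ∧ (∀ a ∈ T, a - 1 ∈ 𝔪 p) ∧
      (∀ a ∈ T, ∃ b ∈ T, a * b = 1) ∧ ∃ (g : ℕ → ℕ) (C : ℝ),
        ∀ k, residueCount (T : Set (R p)) k = p ^ g k ∧ |(g k : ℝ) - β * k| ≤ C := by
  classical
  rcases h0.eq_or_lt with rfl | h0
  · refine ⟨⊥, ?_, ?_, ?_, 0, 0, fun k => ⟨?_, by simp⟩⟩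
    · rw [Submonoid.coe_bot]; exact isClosed_singleton
    · rintro a rfl; simp
    · rintro a rfl; exact ⟨1, one_mem _, by simp⟩
    · rw [Submonoid.coe_bot, residueCount_singleton]; simp
  have hp1 : 1 < p := (Fact.out : p.Prime).one_lt
  have hp1' : (1 : ℝ) < p := by exact_mod_cast hp1
  obtain ⟨j, hj1, hj2⟩ := exists_nat_pow_near_of_lt_one h0 h1 (y := (p : ℝ)⁻¹) (by positivity)
    (inv_lt_one_of_one_lt₀ hp1')
  have hq : (0 : ℝ) < (p : ℝ) ^ j := by positivity
  obtain ⟨E, hE, hcard⟩ := exists_compl_density (p := p) (β := β * p ^ j)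
    (by
      rw [pow_succ', inv_pow, ← div_eq_mul_inv, div_lt_iff₀ hq] at hj1
      exact hj1.le)
    (by rwa [inv_pow, le_inv_comm₀ h0 hq, ← one_div, le_div_iff₀ h0, mul_comm] at hj2)
  refine ⟨(logDerivSubmonoid p E).map (powMonoidHom (p ^ j)), ?_, ?_, ?_,
    fun k => ((Finset.Icc 1 (k / p ^ j)).filter (· ∉ E)).card, 3 + β * p ^ j, fun k => ⟨?_, ?_⟩⟩
  · have : CompactSpace (R p) := inferInstance
    exact ((isClosed_logDerivSubmonoid hE).isCompact.image (continuous_pow (p ^ j))).isClosed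
  · rintro _ ⟨f, hf, rfl⟩
    exact sub_one_mem_of_constantCoeff (by simp [hf.1])
  · rintro _ ⟨f, hf, rfl⟩
    obtain ⟨g, hg, hfg⟩ := exists_inv_logDerivSubmonoid hf
    exact ⟨_, ⟨g, hg, rfl⟩, by simp [← mul_pow, hfg]⟩
  · exact (residueCount_image_pow _ j k).trans (residueCount_logDerivSubmonoid hE _)
  · have h2 := abs_le.1 (hcard (k / p ^ j))
    have h3 : ((k / p ^ j : ℕ) : ℝ) * p ^ j ≤ k := by exact_mod_cast Nat.div_mul_le_self k (p ^ j)
    have h4 : (k : ℝ) ≤ ((k / p ^ j : ℕ) : ℝ) * p ^ j + p ^ j := by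
      exact_mod_cast (Nat.lt_div_mul_add (a := k) (pow_pos (by omega : 0 < p) j)).le
    rw [abs_le]
    constructor <;> nlinarith

end TorusSubgroup

/-! ### Indices of congruence subgroups -/

section IndexCount

open scoped NNReal

variable {p n : ℕ} [Fact p.Prime]

/-- The index of a congruence subgroup in a group given by independent conditions on the entries off
the corner is computed entry by entry. -/
theorem SL.relIndex_congruence (l : Fin n) (k : ℕ) (X : Fin n → Fin n → Set (R p))
    (hX : ∀ i j, (i, j) ≠ (l, l) → ∀ a ∈ X i j,
      a - (1 : Matrix (Fin n) (Fin n) (R p)) i j ∈ 𝔪 p)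
    (K : Subgroup (SL n p)) (hK : ∀ x, x ∈ K ↔ x ∈ SL.congruence n p 0 ∧
      ∀ i j, (i, j) ≠ (l, l) → x.1 i j ∈ X i j) :
    (SL.congruence n p k).relIndex K =
      ∏ ij : {ij : Fin n × Fin n // ij ≠ (l, l)}, residueCount (X ij.1.1 ij.1.2) k := by
  rw [SL.congruence, Subgroup.relIndex_ker]
  simp only [residueCount, ← Nat.card_coe_set_eq]
  rw [← Nat.card_pi]
  let φ : K.map (SL.reduction n p k) → ∀ ij : {ij : Fin n × Fin n // ij ≠ (l, l)},
      (Ideal.Quotient.mk (𝔪 p ^ (k + 1)) '' X ij.1.1 ij.1.2 : Set (R p ⧸ 𝔪 p ^ (k + 1))) :=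
    fun A ij => ⟨A.1.1 ij.1.1 ij.1.2, by
      obtain ⟨x, hx, hxA⟩ := A.2
      exact ⟨x.1 ij.1.1 ij.1.2, ((hK x).1 hx).2 _ _ ij.2, by rw [← hxA]; rfl⟩⟩
  refine Nat.card_congr (Equiv.ofBijective φ ⟨?_, ?_⟩)
  · rintro ⟨_, x, hx, rfl⟩ ⟨_, y, hy, rfl⟩ hxy
    refine Subtype.ext (SL.reduction_eq_of_off_corner (l := l) ((hK x).1 hx).1 fun i j hij => ?_)
    exact Ideal.Quotient.eq.1 (congrArg Subtype.val (congrFun hxy ⟨(i, j), hij⟩))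
  · intro v
    choose a ha hav using fun ij => (v ij).2
    obtain ⟨x, hx, hxa⟩ := SL.exists_mem_congruence_zero (l := l)
      (fun i j => if h : (i, j) ≠ (l, l) then a ⟨(i, j), h⟩ else 0) fun i j hij => by
        rw [dif_pos hij]; exact hX i j hij _ (ha ⟨(i, j), hij⟩)
    have hxa' : ∀ i j (hij : (i, j) ≠ (l, l)), x.1 i j = a ⟨(i, j), hij⟩ := fun i j hij => by
      rw [hxa i j hij, dif_pos hij]
    have hxK : x ∈ K := (hK x).2 ⟨hx, fun i j hij => by rw [hxa' i j hij]; exact ha ⟨(i, j), hij⟩⟩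
    refine ⟨⟨_, x, hxK, rfl⟩, funext fun ij => Subtype.ext ?_⟩
    rw [← hav ij]
    exact congrArg _ (hxa' _ _ ij.2)

theorem card_off_corner (l : Fin n) :
    Fintype.card {ij : Fin n × Fin n // ij ≠ (l, l)} = n * n - 1 := by
  rw [Fintype.card_subtype_compl, Fintype.card_prod, Fintype.card_fin, Fintype.card_subtype_eq]

theorem SL.relIndex_congruence_zero (l : Fin n) (k : ℕ) :
    (SL.congruence n p k).relIndex (SL.congruence n p 0) = p ^ (k * (n * n - 1)) := by
  rw [SL.relIndex_congruence l k
    (fun i j => {a | a - (1 : Matrix (Fin n) (Fin n) (R p)) i j ∈ 𝔪 p}) (fun _ _ _ _ h => h) _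
    fun x => ⟨fun h => ⟨h, fun i j _ => SL.mem_congruence_zero.1 h i j⟩, fun h => h.1⟩]
  simp only [residueCount_coset, Finset.prod_const, Finset.card_univ, card_off_corner, ← pow_mul]

theorem SL.index_congruence (l : Fin n) (k : ℕ) :
    (SL.congruence n p k).index = p ^ (k * (n * n - 1)) * (SL.congruence n p 0).index := by
  rw [← Subgroup.relIndex_mul_index (SL.congruence_antitone (Nat.zero_le k)),
    SL.relIndex_congruence_zero l]

theorem SL.index_congruence_ne_zero (k : ℕ) : (SL.congruence n p k).index ≠ 0 := by
  have := Subgroup.quotient_finite_of_isOpen (SL.congruence n p k) (SL.isOpen_congruence k)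
  exact Subgroup.finiteIndex_of_finite_quotient.index_ne_zero

/-- The standard Hausdorff dimension of a subgroup is the exponential growth rate of its images modulo
powers of `t`, divided by the dimension of `SL_n`. -/
theorem SL.hdim_eq (hn : 2 ≤ n) (S : StandardSubgroup (SL.entries n p)) (H : Subgroup (SL n p))
    (hH : IsClosed (H : Set (SL n p))) {σ C : ℝ} (hσ : 0 ≤ σ) (g : ℕ → ℕ)
    (hg : ∀ k, (SL.congruence n p k).relIndex H = p ^ g k) (hC : ∀ k, |(g k : ℝ) - σ * k| ≤ C) :
    S.filtration.hdim (H : Set (SL n p)) = ENNReal.ofReal (σ / (n ^ 2 - 1)) := by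
  obtain ⟨c, h1, h2⟩ := SL.exists_interlacing S
  let l : Fin n := ⟨0, by omega⟩
  have hp1 : 1 < p := (Fact.out : p.Prime).one_lt
  have hp1' : (1 : ℝ≥0) < p := by exact_mod_cast hp1
  have hp0 : (p : ℝ≥0) ≠ 0 := by positivity
  set D := n * n - 1 with hD
  have hD0 : 0 < D := by
    have : 2 * 2 ≤ n * n := Nat.mul_le_mul hn hn
    omega
  have hDr : (D : ℝ) = n ^ 2 - 1 := by
    rw [hD, Nat.cast_sub (by nlinarith)]
    push_cast
    ring
  set N : ℕ := (SL.congruence n p 0).index with hN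
  have hN1 : (1 : ℝ≥0) ≤ N := by
    exact_mod_cast Nat.one_le_iff_ne_zero.2 (SL.index_congruence_ne_zero 0)
  set ρ : ℝ≥0 := ((p : ℝ≥0)⁻¹) ^ D with hρ
  set A : ℝ≥0 := N + (p : ℝ≥0) ^ C with hA
  have hA1 : 1 ≤ A := hN1.trans le_self_add
  have hG : ∀ k, ((SL.congruence n p k).index : ℝ≥0) * ρ ^ k = N := fun k => by
    rw [SL.index_congruence l, hρ, ← pow_mul, mul_comm D k]
    push_cast
    rw [mul_right_comm, ← mul_pow, mul_inv_cancel₀ hp0, one_pow, one_mul]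
  set r : ℝ≥0 := ⟨σ / D, by positivity⟩ with hr
  have hH' : ∀ k, ((SL.congruence n p k).relIndex H : ℝ≥0) * (ρ ^ k) ^ (r : ℝ) =
      (p : ℝ≥0) ^ ((g k : ℝ) - σ * k) := fun k => by
    have h3 : (ρ ^ k) ^ (r : ℝ) = (p : ℝ≥0) ^ (-(σ * k)) := by
      have : (r : ℝ) = σ / D := rfl
      rw [hρ, ← pow_mul, inv_pow, ← NNReal.rpow_natCast, ← NNReal.rpow_neg, ← NNReal.rpow_mul, this]
      congr 1
      push_cast
      have : (D : ℝ) ≠ 0 := by positivity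
      field_simp
    rw [hg, h3, sub_eq_add_neg, NNReal.rpow_add hp0, NNReal.rpow_natCast]
    push_cast
    rfl
  have hfin := S.filtration.hdim_eq (Γ := SL.congruence n p) (c := c) (ρ := ρ) (A := A) (r := r)
    (fun k => SL.isClosed_congruence k) h1 h2 (by positivity) (by positivity)
    (pow_lt_one₀ zero_le (inv_lt_one_of_one_lt₀ hp1') hD0.ne')
    (fun k => by rw [hG]; exact (inv_le_one_of_one_le₀ hA1).trans hN1)
    (fun k => by rw [hG]; exact le_self_add) H hH
    (fun k => by
      rw [hH']
      calc A⁻¹ ≤ ((p : ℝ≥0) ^ C)⁻¹ := inv_anti₀ (by positivity) le_add_self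
        _ = (p : ℝ≥0) ^ (-C) := (NNReal.rpow_neg _ _).symm
        _ ≤ _ := NNReal.rpow_le_rpow_of_exponent_le hp1'.le (abs_le.1 (hC k)).1)
    (fun k => by
      rw [hH']
      exact (NNReal.rpow_le_rpow_of_exponent_le hp1'.le (abs_le.1 (hC k)).2).trans le_add_self)
  rw [hfin, ← hDr, ← ENNReal.ofReal_coe_nnreal]
  rfl

end IndexCount

/-! ### Groups of triangular matrices -/

section BorelSubgroups

variable {p n : ℕ} [Fact p.Prime]

/-- A closed submonoid of a compact group is a group. -/
theorem inv_mem_of_isClosed_of_mul_mem {G : Type*} [Group G] [TopologicalSpace G]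
    [IsTopologicalGroup G] [CompactSpace G] {A : Submonoid G} (hA : IsClosed (A : Set G)) {x : G}
    (hx : x ∈ A) : x⁻¹ ∈ A := by
  have h1 : x⁻¹ ∈ closure (Set.range (x ^ · : ℤ → G)) := subset_closure ⟨-1, by simp⟩
  rw [closure_range_zpow_eq_pow] at h1
  refine closure_minimal ?_ hA h1
  rintro _ ⟨k, rfl⟩
  exact pow_mem hx k

/-- The upper triangular matrices in the first congruence subgroup whose diagonal entries lie in
`T` and whose `h` first superdiagonals vanish. -/
def SL.triangularSubmonoid (n : ℕ) {p : ℕ} [Fact p.Prime] (T : Submonoid (R p)) (h : ℕ) :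
    Submonoid (SL n p) where
  carrier := {x | x ∈ SL.congruence n p 0 ∧ (∀ i, x.1 i i ∈ T) ∧
    ∀ i j : Fin n, i ≠ j → ¬ (i : ℕ) + h < j → x.1 i j = 0}
  one_mem' := ⟨one_mem _, fun i => by simp, fun i j hij _ => by simp [hij]⟩
  mul_mem' := by
    intro x y hx hy
    have hterm : ∀ i j k : Fin n, k ≠ i → k ≠ j → ¬ ((i : ℕ) + h < j) → x.1 i k * y.1 k j = 0 := by
      intro i j k hki hkj hij
      by_cases h1 : (i : ℕ) + h < k
      · by_cases h2 : (k : ℕ) + h < j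
        · omega
        · rw [hy.2.2 k j hkj h2, mul_zero]
      · rw [hx.2.2 i k hki.symm h1, zero_mul]
    refine ⟨mul_mem hx.1 hy.1, fun i => ?_, fun i j hij hijh => ?_⟩
    · have : (x * y).1 i i = x.1 i i * y.1 i i := by
        rw [Matrix.SpecialLinearGroup.coe_mul, Matrix.mul_apply]
        exact Finset.sum_eq_single i (fun k _ hk => hterm i i k hk hk (by omega)) (by simp)
      rw [this]
      exact mul_mem (hx.2.1 i) (hy.2.1 i)
    · rw [Matrix.SpecialLinearGroup.coe_mul, Matrix.mul_apply]
      refine Finset.sum_eq_zero fun k _ => ?_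
      by_cases hki : k = i
      · rw [hki, hy.2.2 i j hij hijh, mul_zero]
      by_cases hkj : k = j
      · rw [hkj, hx.2.2 i j hij hijh, zero_mul]
      exact hterm i j k hki hkj hijh

variable {T : Submonoid (R p)} {h : ℕ}

theorem SL.mem_triangularSubmonoid {x : SL n p} : x ∈ SL.triangularSubmonoid n T h ↔
    x ∈ SL.congruence n p 0 ∧ (∀ i, x.1 i i ∈ T) ∧
      ∀ i j : Fin n, i ≠ j → ¬ (i : ℕ) + h < j → x.1 i j = 0 := Iff.rfl

theorem SL.isClosed_triangularSubmonoid (hT : IsClosed (T : Set (R p))) :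
    IsClosed (SL.triangularSubmonoid n T h : Set (SL n p)) := by
  have : (SL.triangularSubmonoid n T h : Set (SL n p)) = (SL.congruence n p 0 : Set (SL n p)) ∩
      ((⋂ i, {x | x.1 i i ∈ T}) ∩
        ⋂ (i : Fin n) (j : Fin n) (_ : i ≠ j) (_ : ¬ (i : ℕ) + h < j), {x | x.1 i j = 0}) := by
    ext x
    simp [SL.mem_triangularSubmonoid]
  rw [this]
  refine (SL.isClosed_congruence 0).inter ((isClosed_iInter fun i => ?_).inter
    (isClosed_iInter fun i => isClosed_iInter fun j => isClosed_iInter fun _ =>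
      isClosed_iInter fun _ => ?_))
  · exact hT.preimage (SL.continuous_entry i i)
  · exact isClosed_eq (SL.continuous_entry i j) continuous_const

/-- The closed subgroup of `SL_n` underlying `SL.triangularSubmonoid`. -/
def SL.triangularSubgroup (n : ℕ) {p : ℕ} [Fact p.Prime] {T : Submonoid (R p)}
    (hT : IsClosed (T : Set (R p))) (h : ℕ) : Subgroup (SL n p) where
  __ := SL.triangularSubmonoid n T h
  inv_mem' := inv_mem_of_isClosed_of_mul_mem (SL.isClosed_triangularSubmonoid hT)

/-- The admissible values of the `(i, j)` entry of a matrix in `SL.triangularSubgroup`. The maximal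
ideal is written as the coset of `0`, the entry of the identity matrix. -/
def triangularEntries (T : Submonoid (R p)) (h : ℕ) (i j : Fin n) : Set (R p) :=
  if i = j then T else if (i : ℕ) + h < j then {a | a - 0 ∈ 𝔪 p} else {0}

/-- The last diagonal entry of a triangular matrix of determinant one is the inverse of the
product of the others, so that no condition on it is needed. -/
theorem SL.mem_triangularSubgroup_iff (hT : IsClosed (T : Set (R p)))
    (hinv : ∀ a ∈ T, ∃ b ∈ T, a * b = 1) (l : Fin n) (x : SL n p) :
    x ∈ SL.triangularSubgroup n hT h ↔ x ∈ SL.congruence n p 0 ∧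
      ∀ i j, (i, j) ≠ (l, l) → x.1 i j ∈ triangularEntries T h i j := by
  constructor
  · rintro ⟨h1, h2, h3⟩
    refine ⟨h1, fun i j _ => ?_⟩
    rw [triangularEntries]
    split_ifs with hij hh
    · subst hij; exact h2 i
    · simpa [hij] using SL.mem_congruence_zero.1 h1 i j
    · exact h3 i j hij hh
  · rintro ⟨h1, h2⟩
    have hoff : ∀ i j : Fin n, i ≠ j → ¬ (i : ℕ) + h < j → x.1 i j = 0 := fun i j hij hh => by
      have := h2 i j fun he => hij ((Prod.ext_iff.1 he).1.trans (Prod.ext_iff.1 he).2.symm)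
      rwa [triangularEntries, if_neg hij, if_neg hh] at this
    have hdiag : ∀ i, i ≠ l → x.1 i i ∈ T := fun i hi => by
      have := h2 i i fun he => hi (Prod.ext_iff.1 he).1
      rwa [triangularEntries, if_pos rfl] at this
    refine ⟨h1, fun i => ?_, hoff⟩
    by_cases hi : i = l
    · subst hi
      have hdet : x.1.det = ∏ j, x.1 j j := Matrix.det_of_isUpperTriangular fun a b hab => by
        have : (b : ℕ) < a := hab
        exact hoff a b (by rintro rfl; omega) (by omega)
      rw [x.2, ← Finset.mul_prod_erase _ _ (Finset.mem_univ i)] at hdet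
      obtain ⟨b, hb, hab⟩ := hinv (∏ j ∈ Finset.univ.erase i, x.1 j j)
        (prod_mem fun j hj => hdiag j (Finset.ne_of_mem_erase hj))
      have : x.1 i i = b := by
        calc x.1 i i = x.1 i i * ((∏ j ∈ Finset.univ.erase i, x.1 j j) * b) := by rw [hab, mul_one]
          _ = b := by rw [← mul_assoc, ← hdet, one_mul]
      rwa [this]
    · exact hdiag i hi

/-- The number of entries above the `h` first superdiagonals. -/
def superdiagonalCount (n h : ℕ) : ℕ :=
  (Finset.univ.filter fun ij : Fin n × Fin n => (ij.1 : ℕ) + h < ij.2).card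

theorem superdiagonalCount_self (n : ℕ) : superdiagonalCount n n = 0 := by
  rw [superdiagonalCount, Finset.card_eq_zero, Finset.filter_eq_empty_iff]
  intro ij _
  have := ij.2.isLt
  omega

theorem superdiagonalCount_le (n h : ℕ) :
    superdiagonalCount n h ≤ superdiagonalCount n (h + 1) + (n - 1) := by
  classical
  have h1 : (Finset.univ.filter fun ij : Fin n × Fin n => (ij.1 : ℕ) + h < ij.2) ⊆
      (Finset.univ.filter fun ij : Fin n × Fin n => (ij.1 : ℕ) + (h + 1) < ij.2) ∪
      (Finset.univ.filter fun ij : Fin n × Fin n => (ij.1 : ℕ) + (h + 1) = ij.2) := by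
    intro ij hij
    simp only [Finset.mem_union, Finset.mem_filter, Finset.mem_univ, true_and] at hij ⊢
    omega
  refine (Finset.card_le_card h1).trans ((Finset.card_union_le _ _).trans ?_)
  refine Nat.add_le_add_left ?_ _
  calc _ ≤ (Finset.Icc 1 (n - 1)).card := by
        refine Finset.card_le_card_of_injOn (fun ij => (ij.2 : ℕ)) (fun ij hij => ?_) ?_
        · have := (Finset.mem_filter.1 hij).2
          have hlt := ij.2.isLt
          exact Finset.mem_coe.2 (Finset.mem_Icc.2 ⟨by dsimp only; omega, by dsimp only; omega⟩)
        · intro ij hij kl hkl hh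
          have e1 := (Finset.mem_filter.1 hij).2
          have e2 := (Finset.mem_filter.1 hkl).2
          simp only at hh
          exact Prod.ext (Fin.ext (by omega)) (Fin.ext hh)
    _ = n - 1 := by simp

theorem two_mul_superdiagonalCount_zero (n : ℕ) : 2 * superdiagonalCount n 0 + n = n * n := by
  have h1 : superdiagonalCount n 0 =
      (Finset.univ.filter fun ij : Fin n × Fin n => (ij.2 : ℕ) < ij.1).card := by
    refine Finset.card_bij (fun ij _ => (ij.2, ij.1)) (by simp) ?_ ?_
    · rintro ⟨a, b⟩ _ ⟨c, d⟩ _ he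
      simp only [Prod.mk.injEq] at he ⊢
      exact ⟨he.2, he.1⟩
    · rintro ⟨a, b⟩ hb
      exact ⟨(b, a), by simpa using hb, rfl⟩
  have h2 : (Finset.univ.filter fun ij : Fin n × Fin n => ij.1 = ij.2).card = n := by
    rw [show (Finset.univ.filter fun ij : Fin n × Fin n => ij.1 = ij.2) =
      Finset.univ.image (fun i : Fin n => (i, i)) by ext ⟨a, b⟩; simp [eq_comm],
      Finset.card_image_of_injective _ fun a b hab => (Prod.ext_iff.1 hab).1]
    simp
  have h3 : (Finset.univ : Finset (Fin n × Fin n)) =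
      ((Finset.univ.filter fun ij : Fin n × Fin n => (ij.1 : ℕ) + 0 < ij.2) ∪
        Finset.univ.filter fun ij : Fin n × Fin n => (ij.2 : ℕ) < ij.1) ∪
        Finset.univ.filter fun ij : Fin n × Fin n => ij.1 = ij.2 := by
    ext ij
    simp only [Finset.mem_union, Finset.mem_filter, Finset.mem_univ, true_and, Fin.ext_iff, true_iff]
    omega
  have h4 := congrArg Finset.card h3
  rw [Finset.card_union_of_disjoint, Finset.card_union_of_disjoint, h2, ← h1] at h4
  · rw [Finset.card_univ, Fintype.card_prod, Fintype.card_fin] at h4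
    rw [h4, superdiagonalCount]
    ring
  · rw [Finset.disjoint_filter]
    intro ij _
    omega
  · rw [Finset.disjoint_left]
    intro ij
    simp only [Finset.mem_union, Finset.mem_filter, Finset.mem_univ, true_and, Fin.ext_iff]
    omega

theorem sum_off_corner_eq (l : Fin n) (h : ℕ) (β : ℝ) :
    ∑ ij : {ij : Fin n × Fin n // ij ≠ (l, l)},
      (if ij.1.1 = ij.1.2 then β else if (ij.1.1 : ℕ) + h < ij.1.2 then 1 else 0) =
    β * (n - 1) + superdiagonalCount n h := by
  let f : Fin n × Fin n → ℝ := fun ij =>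
    if ij.1 = ij.2 then β else if (ij.1 : ℕ) + h < ij.2 then 1 else 0
  have h1 : ∑ ij ∈ Finset.univ.erase (l, l), f ij =
      ∑ ij : {ij : Fin n × Fin n // ij ≠ (l, l)}, f ij.1 :=
    Finset.sum_subtype _ (by simp) f
  have h2 := Finset.add_sum_erase Finset.univ f (Finset.mem_univ (l, l))
  have h3 : ∀ ij, f ij = (if ij.1 = ij.2 then β else 0) +
      if (ij.1 : ℕ) + h < ij.2 then 1 else 0 := fun ij => by
    simp only [f]
    by_cases hij : ij.1 = ij.2
    · rw [if_pos hij, if_pos hij, if_neg (by rw [hij]; omega), add_zero]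
    · rw [if_neg hij, if_neg hij, zero_add]
  have h4 : ∑ ij, f ij = n * β + superdiagonalCount n h := by
    simp only [h3, Finset.sum_add_distrib]
    congr 1
    · rw [Fintype.sum_prod_type]
      simp
    · rw [Finset.sum_boole, superdiagonalCount]
  have h5 : f (l, l) = β := if_pos rfl
  change ∑ ij : {ij : Fin n × Fin n // ij ≠ (l, l)}, f ij.1 = _
  linarith

theorem SL.relIndex_triangularSubgroup (hT : IsClosed (T : Set (R p)))
    (hT1 : ∀ a ∈ T, a - 1 ∈ 𝔪 p) (hinv : ∀ a ∈ T, ∃ b ∈ T, a * b = 1) {g : ℕ → ℕ}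
    (hg : ∀ k, residueCount (T : Set (R p)) k = p ^ g k) (l : Fin n) (k : ℕ) :
    (SL.congruence n p k).relIndex (SL.triangularSubgroup n hT h) =
      p ^ ∑ ij : {ij : Fin n × Fin n // ij ≠ (l, l)},
        if ij.1.1 = ij.1.2 then g k else if (ij.1.1 : ℕ) + h < ij.1.2 then k else 0 := by
  rw [SL.relIndex_congruence l k (triangularEntries T h) ?_ _
    (SL.mem_triangularSubgroup_iff hT hinv l), ← Finset.prod_pow_eq_pow_sum]
  · refine Finset.prod_congr rfl fun ij _ => ?_
    rw [triangularEntries]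
    split_ifs
    · exact hg k
    · exact residueCount_coset 0 k
    · rw [residueCount_singleton, pow_zero]
  · intro i j _ a ha
    rw [triangularEntries] at ha
    split_ifs at ha with hij
    · subst hij
      rw [Matrix.one_apply_eq]
      exact hT1 a ha
    · rw [Matrix.one_apply_ne hij]
      exact ha
    · rw [Matrix.one_apply_ne hij, Set.mem_singleton_iff.1 ha, sub_zero]
      exact zero_mem _

/-- A closed subgroup whose standard Hausdorff dimension is a prescribed combination of a density
`β` on the diagonal and the number of free entries above it. -/
theorem exists_mem_standardHausdorffSpectrum (hn : 2 ≤ n) {β : ℝ} (h0 : 0 ≤ β) (h1 : β ≤ 1)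
    (h : ℕ) : (β * (n - 1) + superdiagonalCount n h) / ((n : ℝ) ^ 2 - 1) ∈
      standardHausdorffSpectrum (SL.entries n p) := by
  obtain ⟨T, hT, hT1, hinv, g, C, hg⟩ := exists_submonoid_growth (p := p) h0 h1
  let l : Fin n := ⟨0, by omega⟩
  have hn' : (2 : ℝ) ≤ n := by exact_mod_cast hn
  have hσ : 0 ≤ β * (n - 1) + superdiagonalCount n h := by
    have : 0 ≤ β * ((n : ℝ) - 1) := mul_nonneg h0 (by linarith)
    positivity
  have hcl : IsClosed (SL.triangularSubgroup n hT h : Set (SL n p)) :=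
    SL.isClosed_triangularSubmonoid hT
  refine ⟨SL.triangularSubgroup n hT h, hcl, div_nonneg hσ (by nlinarith),
    SL.nonempty_standardSubgroup l, fun S => ?_⟩
  refine SL.hdim_eq hn S _ hcl hσ _
    (SL.relIndex_triangularSubgroup hT hT1 hinv (fun k => (hg k).1) l)
    (C := ∑ _ij : {ij : Fin n × Fin n // ij ≠ (l, l)}, C) fun k => ?_
  have hC : 0 ≤ C := (abs_nonneg _).trans (hg 0).2
  rw [← sum_off_corner_eq l, Finset.sum_mul, Nat.cast_sum, ← Finset.sum_sub_distrib]
  refine (Finset.abs_sum_le_sum_abs _ _).trans (Finset.sum_le_sum fun ij _ => ?_)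
  split_ifs
  · exact (hg k).2
  · simpa using hC
  · simpa using hC

end BorelSubgroups

end StandardHausdorff

theorem corollary5p1 (p n : ℕ) [Fact p.Prime] (hn : 2 ≤ n) :
    Set.Icc (0 : ℝ) (((n : ℝ) * (n + 1) - 2) / (2 * (n : ℝ) ^ 2 - 2)) ⊆
      StandardHausdorff.standardHausdorffSpectrum (StandardHausdorff.SL.entries n p) := by
  rintro α ⟨hα0, hα1⟩
  have hn' : (2 : ℝ) ≤ n := by exact_mod_cast hn
  have hD : (0 : ℝ) < (n : ℝ) ^ 2 - 1 := by nlinarith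
  set s : ℝ := α * ((n : ℝ) ^ 2 - 1) with hs
  have hs0 : 0 ≤ s := mul_nonneg hα0 hD.le
  have h0 : 2 * (StandardHausdorff.superdiagonalCount n 0 : ℝ) + n = n * n := by
    exact_mod_cast StandardHausdorff.two_mul_superdiagonalCount_zero n
  have hs1 : s ≤ StandardHausdorff.superdiagonalCount n 0 + (n - 1) := by
    rw [le_div_iff₀ (by linarith)] at hα1
    rw [hs]
    linarith
  -- Take the smallest number of vanishing superdiagonals that leaves at most `s` free entries.
  have hex : ∃ h, (StandardHausdorff.superdiagonalCount n h : ℝ) ≤ s :=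
    ⟨n, by rw [StandardHausdorff.superdiagonalCount_self]; simpa using hs0⟩
  classical
  obtain ⟨h, hh1, hh2⟩ : ∃ h, (StandardHausdorff.superdiagonalCount n h : ℝ) ≤ s ∧
      s ≤ StandardHausdorff.superdiagonalCount n h + (n - 1) := by
    refine ⟨Nat.find hex, Nat.find_spec hex, ?_⟩
    rcases Nat.eq_zero_or_pos (Nat.find hex) with hz | hz
    · rw [hz]; exact hs1
    · obtain ⟨m, hm⟩ := Nat.exists_eq_succ_of_ne_zero hz.ne'
      have h3 := Nat.find_min hex (m := m) (by omega)
      have h4 : (StandardHausdorff.superdiagonalCount n m : ℝ) ≤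
          StandardHausdorff.superdiagonalCount n (m + 1) + ((n - 1 : ℕ) : ℝ) := by
        exact_mod_cast StandardHausdorff.superdiagonalCount_le n m
      rw [Nat.cast_sub (by omega), Nat.cast_one] at h4
      rw [hm]
      push Not at h3
      exact h3.le.trans h4
  have hn1 : (0 : ℝ) < n - 1 := by linarith
  have := StandardHausdorff.exists_mem_standardHausdorffSpectrum (p := p) hn
    (β := (s - StandardHausdorff.superdiagonalCount n h) / (n - 1))
    (div_nonneg (by linarith) hn1.le) ((div_le_one hn1).2 (by linarith)) h
  rwa [div_mul_cancel₀ _ hn1.ne', sub_add_cancel, hs, mul_div_cancel_right₀ _ hD.ne'] at this
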